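/- For $0<\beta\le 1$ let $$E_\beta(z)=\sum_{n=0}^\infty \frac{z^n}{\Gamma(\beta n+1)},\qquad z\in\mathbb{C},$$ be the Mittag-Leffler function. For $\lambda>0$ let $\pi_{\lambda,\beta}$ be the fractional Poisson measure on $\mathbb{N}_0=\{0,1,2,\dots\}$, $$\pi_{\lambda,\beta}(B)=\sum_{k\in B}\frac{\lambda^k}{k!}\,E_\beta^{(k)}(-\lambda),\qquad B\subseteq\mathbb{N}_0,$$ and for $\lambda\ge 0$ let $\pi_\lambda$ be the Poisson measure on $\mathbb{N}_0$, $\pi_\lambda(\{k\})=\mathrm{e}^{-\lambda}\lambda^k/k!$ (so $\pi_0=\delta_0$). Let $\nu_1=\delta_1$ be the Dirac measure at $1$, and for $0<\beta<1$ let $\nu_\beta$ be the measure on $[0,\infty)$ with density $$\tau\mapsto W_{-\beta,1-\beta}(-\tau)=\sum_{n=0}^\infty\frac{(-\tau)^n}{n!\,\Gamma(-\beta n+1-\beta)}$$ with respect to Lebesgue measure, where $W_{a,b}(x)=\sum_{n\ge0}\frac{x^n}{n!\,\Gamma(an+b)}$ is the Wright function and $1/\Gamma$ is understood to be $0$ at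 the poles of $\Gamma$. **Lemma 3.1.** Let $0<\beta\le1$. The density above is nonnegative (if $\beta<1$), $\nu_\beta$ is a probability measure, and for every $\lambda>0$ the numbers $E_\beta^{(k)}(-\lambda)$, $k\in\mathbb{N}_0$, are real and nonnegative and the fractional Poisson measure is the mixture of Poisson measures $$\pi_{\lambda,\beta}=\int_0^\infty \pi_{\lambda\tau}\,\mathrm{d}\nu_\beta(\tau),$$ that is, $\pi_{\lambda,\beta}(B)=\int_{[0,\infty)}\pi_{\lambda\tau}(B)\,\mathrm{d}\nu_\beta(\tau)$ for every $B\subseteq\mathbb{N}_0$. -/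

import Mathlib

open MeasureTheory ProbabilityTheory
open scoped NNReal ENNReal Nat ComplexOrder

noncomputable section

/-- The Mittag-Leffler function `E_β(z) = ∑ zⁿ / Γ(β n + 1)`, `z ∈ ℂ`. -/
def mittagLeffler (β : ℝ) (z : ℂ) : ℂ :=
  ∑' n : ℕ, z ^ n / Complex.Gamma ((β : ℂ) * (n : ℂ) + 1)

/-- The weight `π_{l,β}({k}) = l ^ k / k! * E_β^{(k)}(-l)`. The derivatives of `E_β` are the complex
ones; they are real at real points, so that taking the real part only changes the type. -/
def fractionalPoissonWeight (β : ℝ) (l : ℝ≥0) (k : ℕ) : ℝ :=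
  (l : ℝ) ^ k / (k ! : ℝ) * (iteratedDeriv k (mittagLeffler β) (-((l : ℝ) : ℂ))).re

/-- The fractional Poisson measure `π_{l,β}` on `ℕ`: the mass of `B` is the sum over `k ∈ B` of
`fractionalPoissonWeight β l k`. -/
def fractionalPoissonMeasure (β : ℝ) (l : ℝ≥0) : Measure ℕ :=
  Measure.sum fun k : ℕ => ENNReal.ofReal (fractionalPoissonWeight β l k) • Measure.dirac k

/-- The Wright function `W_{a,b}(x) = ∑ xⁿ / (n! Γ(a n + b))` at real arguments. At the poles of
the Gamma function `1 / Γ` is `0`, which is also Lean's value. -/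
def wrightFunction (a b x : ℝ) : ℝ :=
  ∑' n : ℕ, x ^ n / ((n ! : ℝ) * Real.Gamma (a * n + b))

/-- The density `τ ↦ W_{-β,1-β}(-τ) = ∑ (-τ)ⁿ / (n! Γ(-β n + 1 - β))` on `[0, ∞)` of the measure
`ν_β`, for `0 < β < 1` (often written `M_β`). -/
def mixingDensity (β : ℝ) (τ : ℝ≥0) : ℝ :=
  wrightFunction (-β) (1 - β) (-(τ : ℝ))

open Classical in
/-- The measure `ν_β` on `[0, ∞)`: it has the density `mixingDensity β` with respect to Lebesgue
measure (restricted from `ℝ`) for `0 < β < 1`, and `ν_1` is the Dirac measure at `1`. -/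
def mixingMeasure (β : ℝ) : Measure ℝ≥0 :=
  if β = 1 then Measure.dirac 1
  else (Measure.comap ((↑) : ℝ≥0 → ℝ) volume).withDensity fun τ => ENNReal.ofReal (mixingDensity β τ)

end

/-! Everything rests on the moments of ν_β. If a measure ν on [0, ∞) has n-th moment n!/Γ(βn+1) for
every n, integrating the exponential series term by term gives E_β(z) = ∫ e^{zτ} dν(τ). The moment
of order 0 makes ν a probability measure, differentiation under the integral gives E_β^{(k)}(-λ) = ∫
τ^k e^{-λτ} dν(τ) ≥ 0, and the factor λ^k/k! turns this into the Poisson mixture, atom by atom. For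
β = 1 the moments of δ_1 are all 1.

For β < 1 the tool is the contour formula `mul_wrightFunction_eq`: πβτ W_{-β,1-β}(-τ) is the
imaginary part of ∫ e^{σ - τσ^β} dσ along any ray of angle θ in (π/2, π). Integrating it against
powers of τ yields the Mellin transform Γ(s)/Γ(1-β+βs) of W_{-β,1-β}(-τ) for 1 < s < 2. Rapid decay
in τ extends this to Re s > 0, and s = n+1 gives the moments.

For the sign of the density, θ → π/2 turns the formula into Re ∫_0^∞ e^{iy} e^{-τ(iy)^β} dy, which
is π times the density at 1 of a one-sided stable law. The factor e^{-τ(iy)^β} is a limit of power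
series in e^{-iεy} with nonnegative coefficients (`exists_hasSum_cexp_neg_mul_cpow`); under a
Gaussian cutoff each term contributes a nonnegative number, and the cutoff is removed at the end. -/

/-! ### Gamma integrals along rays. -/

open Set Filter Topology in
/-- The Gamma integral with a complex rate. -/
theorem integral_rpow_mul_cexp_neg_mul_Ioi {a : ℝ} (ha : 0 < a) {w : ℂ} (hw : 0 < w.re) :
    ∫ t : ℝ in Ioi 0, ((t ^ (a - 1) : ℝ) : ℂ) * Complex.exp (-(w * t)) =
      w ^ (-(a : ℂ)) * (Real.Gamma a : ℂ) := by
  -- Seen as the complex moment generating function of t^{a-1} dt at -w, the integral is holomorphic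
  -- in w without further estimates.
  set μ : Measure ℝ := (volume.restrict (Ioi 0)).withDensity
    fun t => ENNReal.ofReal (t ^ (a - 1)) with hμ
  have hmeas : Measurable fun t : ℝ => t ^ (a - 1) := by fun_prop
  have hpos : ∀ᵐ t : ℝ ∂(volume.restrict (Ioi 0)), 0 ≤ t ^ (a - 1) := by
    filter_upwards [ae_restrict_mem measurableSet_Ioi] with t ht
    exact Real.rpow_nonneg (le_of_lt ht) _
  have hset : Iio (0 : ℝ) ⊆ integrableExpSet id μ := by
    intro s hs
    have hs' : 0 < -s := neg_pos.2 hs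
    simp only [integrableExpSet, mem_ofPred_eq, id, hμ]
    rw [integrable_withDensity_iff_integrable_smul₀' (by fun_prop) (by simp)]
    have := integrableOn_rpow_mul_exp_neg_mul_rpow (p := 1) (s := a - 1) (b := -s)
      (by linarith) one_pos hs'
    refine this.congr ?_
    filter_upwards [hpos] with t ht
    simp [ENNReal.toReal_ofReal ht]
  have hint : ∀ z : ℂ, complexMGF id μ z =
      ∫ t : ℝ in Ioi 0, ((t ^ (a - 1) : ℝ) : ℂ) * Complex.exp (z * t) := by
    intro z
    simp only [complexMGF, hμ, id]
    rw [integral_withDensity_eq_integral_toReal_smul₀ (by fun_prop) (by simp)]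
    refine integral_congr_ae ?_
    filter_upwards [hpos] with t ht
    simp [ENNReal.toReal_ofReal ht]
  have hUo : IsOpen {z : ℂ | 0 < z.re} := isOpen_lt continuous_const Complex.continuous_re
  have h1 : AnalyticOnNhd ℂ (fun z => complexMGF id μ (-z)) {z : ℂ | 0 < z.re} := by
    intro z hz
    have : AnalyticAt ℂ (complexMGF id μ) (-z) := by
      apply analyticAt_complexMGF
      rw [mem_interior_iff_mem_nhds]
      exact Filter.mem_of_superset (Iio_mem_nhds (by simpa using hz)) hset
    exact this.comp_of_eq (f := fun z => -z) (by fun_prop) rfl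
  have h2 : AnalyticOnNhd ℂ (fun z : ℂ => z ^ (-(a : ℂ)) * (Real.Gamma a : ℂ))
      {z : ℂ | 0 < z.re} := by
    refine DifferentiableOn.analyticOnNhd (fun z hz => ?_) hUo
    refine DifferentiableAt.differentiableWithinAt ?_
    refine DifferentiableAt.mul_const ?_ _
    exact (differentiableAt_id).cpow_const (Or.inl hz)
  have hconn : IsPreconnected {z : ℂ | 0 < z.re} :=
    (convex_halfSpace_re_gt 0).isPreconnected
  -- Identity theorem on Re w > 0: the two sides agree at positive real w, which accumulate at 1.
  have key := h1.eqOn_of_preconnected_of_frequently_eq h2 hconn (z₀ := 1) (by simp) ?_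
  · have := key hw
    simp only [hint] at this
    simpa [neg_mul] using this
  · have hreal : ∀ x : ℝ, 0 < x → complexMGF id μ (-(x : ℂ)) =
        (x : ℂ) ^ (-(a : ℂ)) * (Real.Gamma a : ℂ) := by
      intro x hx
      rw [hint]
      have := Real.integral_rpow_mul_exp_neg_mul_Ioi ha hx
      rw [one_div, Real.inv_rpow hx.le, ← Real.rpow_neg hx.le] at this
      rw [← Complex.ofReal_neg a, ← Complex.ofReal_cpow hx.le, ← Complex.ofReal_mul, ← this,
        ← integral_complex_ofReal]
      refine integral_congr_ae (ae_of_all _ fun t => ?_)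
      simp
    have hf : ∃ᶠ x : ℝ in 𝓝[≠] (1 : ℝ), 0 < x := by
      refine Filter.Eventually.frequently ?_
      exact eventually_nhdsWithin_of_eventually_nhds (lt_mem_nhds one_pos)
    have ht : Tendsto (fun x : ℝ => (x : ℂ)) (𝓝[≠] (1 : ℝ)) (𝓝[≠] (1 : ℂ)) := by
      refine tendsto_nhdsWithin_of_tendsto_nhds_of_eventually_within _ ?_ ?_
      · have : Tendsto (fun x : ℝ => (x : ℂ)) (𝓝 1) (𝓝 ((1 : ℝ) : ℂ)) :=
          Complex.continuous_ofReal.tendsto 1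
        simpa using this.mono_left nhdsWithin_le_nhds
      · filter_upwards [self_mem_nhdsWithin] with x hx
        simpa using hx
    exact ht.frequently (hf.mono fun x hx => hreal x hx)

open Set in
/-- The Gamma integral along a ray, in polar form. -/
theorem integral_rpow_mul_cexp_polar_Ioi {a ρ θ : ℝ} (ha : 0 < a) (hρ : 0 < ρ)
    (hθ : |θ| < Real.pi / 2) :
    ∫ t : ℝ in Ioi 0, ((t ^ (a - 1) : ℝ) : ℂ) *
        Complex.exp (-(ρ * Complex.exp (θ * Complex.I) * t)) =
      ((ρ ^ (-a) * Real.Gamma a : ℝ) : ℂ) * Complex.exp (-(a * θ) * Complex.I) := by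
  rw [abs_lt] at hθ
  have hcos : 0 < Real.cos θ := Real.cos_pos_of_mem_Ioo ⟨by linarith, by linarith⟩
  have hre : 0 < ((ρ : ℂ) * Complex.exp (θ * Complex.I)).re := by
    rw [Complex.re_ofReal_mul, Complex.exp_ofReal_mul_I_re]
    positivity
  rw [integral_rpow_mul_cexp_neg_mul_Ioi ha hre]
  have hne : Complex.exp (θ * Complex.I) ≠ 0 := Complex.exp_ne_zero _
  have hpow : ((ρ : ℂ) * Complex.exp (θ * Complex.I)) ^ (-(a : ℂ)) =
      ((ρ ^ (-a) : ℝ) : ℂ) * Complex.exp (-(a * θ) * Complex.I) := by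
    have hl : Complex.log ((ρ : ℂ) * Complex.exp (θ * Complex.I)) =
        Real.log ρ + θ * Complex.I := by
      rw [Complex.log_ofReal_mul hρ hne, Complex.log_exp]
      · simp; linarith [Real.pi_pos]
      · simp; linarith [Real.pi_pos]
    rw [Complex.cpow_def_of_ne_zero (mul_ne_zero (by exact_mod_cast hρ.ne') hne), hl,
      Real.rpow_def_of_pos hρ, Complex.ofReal_exp, ← Complex.exp_add]
    congr 1
    push_cast
    ring
  rw [hpow]
  push_cast
  ring

/-! ### The Wright function as an integral along a ray. -/

open Filter in
/-- A power with exponent below `1` is dominated by any linear function, up to a constant. -/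
theorem exists_mul_rpow_le_add_mul {β a : ℝ} (hβ₀ : 0 < β) (hβ₁ : β < 1) (ha : 0 < a) (C : ℝ) :
    ∃ D : ℝ, ∀ r : ℝ, 0 < r → C * r ^ β ≤ D + a * r := by
  obtain ⟨R, hR⟩ := ((tendsto_rpow_atTop (show 0 < 1 - β by linarith)).eventually_ge_atTop
    (|C| / a)).exists_forall_of_atTop
  refine ⟨|C| * (max R 1) ^ β, fun r hr => ?_⟩
  have h1 : C * r ^ β ≤ |C| * r ^ β := by
    gcongr
    exact le_abs_self C
  refine h1.trans ?_
  rcases le_total r (max R 1) with h | h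
  · have : |C| * r ^ β ≤ |C| * (max R 1) ^ β := by gcongr
    have : 0 ≤ a * r := by positivity
    linarith
  · have h2 := hR r ((le_max_left _ _).trans h)
    rw [div_le_iff₀ ha] at h2
    have h3 : r ^ (1 - β) * r ^ β = r := by
      rw [← Real.rpow_add hr]; simp
    have h4 : |C| * r ^ β ≤ r ^ (1 - β) * a * r ^ β := by gcongr
    have h5 : 0 ≤ |C| * (max R 1) ^ β := by positivity
    nlinarith

open Set in
theorem integrableOn_exp_neg_mul_add_rpow {β a : ℝ} (hβ₀ : 0 < β) (hβ₁ : β < 1) (ha : 0 < a)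
    (C : ℝ) : IntegrableOn (fun r : ℝ => Real.exp (-(a * r)) * Real.exp (C * r ^ β)) (Ioi 0) := by
  obtain ⟨D, hD⟩ := exists_mul_rpow_le_add_mul hβ₀ hβ₁ (half_pos ha) C
  have h : IntegrableOn (fun r : ℝ => Real.exp D * Real.exp (-(a / 2) * r)) (Ioi 0) :=
    (integrableOn_exp_mul_Ioi (by linarith) 0).const_mul _
  refine Integrable.mono' h (by fun_prop) ?_
  filter_upwards [ae_restrict_mem measurableSet_Ioi] with r hr
  rw [Real.norm_of_nonneg (by positivity), ← Real.exp_add, ← Real.exp_add]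
  have := hD r hr
  exact Real.exp_le_exp.2 (by linarith)

/-- The integrand along the ray of angle `θ` in the contour representation of the Wright function:
`e^{σ - τ σ^β} dσ` at `σ = r e^{iθ}`. -/
noncomputable def rayKernel (β τ θ r : ℝ) : ℂ :=
  Complex.exp (θ * Complex.I) * (Complex.exp (r * Complex.exp (θ * Complex.I)) *
    Complex.exp (-(τ * (r ^ β : ℝ) * Complex.exp ((β * θ : ℝ) * Complex.I))))

theorem cexp_mul_I_eq_neg_cexp_sub_pi (θ : ℝ) :
    Complex.exp (θ * Complex.I) = -(Complex.exp ((θ - Real.pi : ℝ) * Complex.I)) := by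
  push_cast
  rw [sub_mul, Complex.exp_sub, Complex.exp_pi_mul_I, div_neg, div_one, neg_neg]

theorem norm_cexp_ofReal_mul_cexp (r θ : ℝ) :
    ‖Complex.exp (r * Complex.exp (θ * Complex.I))‖ = Real.exp (r * Real.cos θ) := by
  rw [Complex.norm_exp, Complex.re_ofReal_mul, Complex.exp_ofReal_mul_I_re]

theorem norm_cexp_neg_rpow_mul_cexp (τ s θ : ℝ) :
    ‖Complex.exp (-(τ * (s : ℝ) * Complex.exp (θ * Complex.I)))‖ =
      Real.exp (-(τ * s * Real.cos θ)) := by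
  rw [← neg_mul, ← Complex.ofReal_mul, ← Complex.ofReal_neg, norm_cexp_ofReal_mul_cexp, neg_mul]

theorem norm_rayKernel (β τ θ r : ℝ) :
    ‖rayKernel β τ θ r‖ =
      Real.exp (r * Real.cos θ) * Real.exp (-(τ * r ^ β * Real.cos (β * θ))) := by
  rw [rayKernel, norm_mul, norm_mul, Complex.norm_exp_ofReal_mul_I, one_mul,
    norm_cexp_ofReal_mul_cexp, norm_cexp_neg_rpow_mul_cexp]

-- Expand e^{-τσ^β} in powers of τ; each term is a Gamma integral of e^σ σ^{βn} along the ray. The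
-- result no longer depends on θ.
open Set in
theorem hasSum_integral_rayKernel {β θ : ℝ} (hβ₀ : 0 < β) (hβ₁ : β < 1) (hθ : Real.pi / 2 < θ)
    (hθ' : θ < Real.pi) (τ : ℝ) :
    HasSum (fun n : ℕ => (((-τ) ^ n / (n ! : ℝ) * Real.Gamma (β * n + 1) : ℝ) : ℂ) *
        Complex.exp ((Real.pi * (β * n + 1) : ℝ) * Complex.I))
      (∫ r in Ioi (0 : ℝ), rayKernel β τ θ r) := by
  have hcos : Real.cos θ < 0 := Real.cos_neg_of_pi_div_two_lt_of_lt hθ (by linarith)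
  set F : ℕ → ℝ → ℂ := fun n r => Complex.exp (θ * Complex.I) *
    (Complex.exp (r * Complex.exp (θ * Complex.I)) *
      ((-(τ * (r ^ β : ℝ) * Complex.exp ((β * θ : ℝ) * Complex.I))) ^ n / (n ! : ℂ))) with hF
  have hFn : ∀ n r, 0 < r → ‖F n r‖ =
      Real.exp (-(-Real.cos θ * r)) * ((|τ| * r ^ β) ^ n / (n ! : ℝ)) := by
    intro n r hr
    simp only [hF]
    rw [norm_mul, norm_mul, Complex.norm_exp_ofReal_mul_I, one_mul, norm_cexp_ofReal_mul_cexp,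
      norm_div, norm_pow, norm_neg, norm_mul, norm_mul, Complex.norm_exp_ofReal_mul_I, mul_one]
    simp [abs_of_nonneg (Real.rpow_nonneg hr.le β), mul_comm]
  have hexp : ∀ x : ℝ, HasSum (fun n : ℕ => x ^ n / (n ! : ℝ)) (Real.exp x) := by
    intro x
    rw [Real.exp_eq_exp_ℝ]
    exact NormedSpace.expSeries_div_hasSum_exp x
  -- The norms of the terms add up to e^{r cos θ + |τ| r^β}, integrable because cos θ < 0 and β < 1.
  have hsum := hasSum_integral_of_dominated_convergence (μ := volume.restrict (Ioi (0 : ℝ)))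
    (F := F) (f := rayKernel β τ θ)
    (fun n r => Real.exp (-(-Real.cos θ * r)) * ((|τ| * r ^ β) ^ n / (n ! : ℝ)))
    (fun n => by
      refine Measurable.aestronglyMeasurable ?_
      simp only [hF]
      fun_prop)
    (fun n => by
      filter_upwards [ae_restrict_mem measurableSet_Ioi] with r hr
      exact (hFn n r hr).le)
    (ae_of_all _ fun r => ((hexp _).mul_left _).summable)
    (by
      refine (integrableOn_exp_neg_mul_add_rpow hβ₀ hβ₁ (neg_pos.2 hcos) |τ|).congr ?_
      refine ae_of_all _ fun r => ?_
      exact (((hexp (|τ| * r ^ β)).mul_left _).tsum_eq).symm)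
    (ae_of_all _ fun r => by
      have h2 : HasSum (fun n : ℕ =>
          (-(τ * (r ^ β : ℝ) * Complex.exp ((β * θ : ℝ) * Complex.I))) ^ n / (n ! : ℂ))
          (Complex.exp (-(τ * (r ^ β : ℝ) * Complex.exp ((β * θ : ℝ) * Complex.I)))) := by
        rw [Complex.exp_eq_exp_ℂ]
        exact NormedSpace.expSeries_div_hasSum_exp _
      exact (h2.mul_left _).mul_left _)
  convert! hsum using 1
  funext n
  -- Since e^{iθ} = -e^{i(θ-π)}, the factor e^σ decays with a rate of angle θ - π, which lies in
  -- (-π/2, 0).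
  have hG := integral_rpow_mul_cexp_polar_Ioi (a := β * n + 1) (ρ := 1) (θ := θ - Real.pi)
    (by positivity) one_pos (by rw [abs_lt]; constructor <;> linarith [Real.pi_pos])
  have hcongr : ∫ r in Ioi (0 : ℝ), F n r = ∫ r in Ioi (0 : ℝ),
      (Complex.exp (θ * Complex.I) * ((((-τ) ^ n / (n ! : ℝ) : ℝ) : ℂ) *
        Complex.exp ((β * θ : ℝ) * Complex.I) ^ n)) *
      (((r ^ (β * n + 1 - 1) : ℝ) : ℂ) *
        Complex.exp (-((1 : ℝ) * Complex.exp ((θ - Real.pi : ℝ) * Complex.I) * r))) := by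
    refine setIntegral_congr_fun measurableSet_Ioi fun r hr => ?_
    have hpw : ((r ^ (β * n + 1 - 1) : ℝ) : ℂ) = ((r ^ β : ℝ) : ℂ) ^ n := by
      rw [add_sub_cancel_right, Real.rpow_mul (le_of_lt hr), Real.rpow_natCast]
      push_cast
      rfl
    simp only [hF]
    rw [hpw]
    have : (r : ℂ) * Complex.exp (θ * Complex.I) =
        -((1 : ℝ) * Complex.exp ((θ - Real.pi : ℝ) * Complex.I) * r) := by
      rw [cexp_mul_I_eq_neg_cexp_sub_pi]; push_cast; ring
    rw [this]
    push_cast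
    rw [neg_pow (_ * _), mul_pow, mul_pow, neg_pow (τ : ℂ)]
    ring
  rw [hcongr, integral_const_mul, hG, Real.one_rpow, one_mul]
  have hX : Complex.exp ((Real.pi * (β * n + 1) : ℝ) * Complex.I) =
      Complex.exp (θ * Complex.I) * Complex.exp ((β * θ : ℝ) * Complex.I) ^ n *
        Complex.exp (-(((β * n + 1 : ℝ) : ℂ) * ((θ - Real.pi : ℝ) : ℂ)) * Complex.I) := by
    rw [← Complex.exp_nat_mul, ← Complex.exp_add, ← Complex.exp_add]
    congr 1
    push_cast
    ring
  rw [hX]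
  push_cast
  ring

/-- The reflection formula in a form that is valid at the poles as well. -/
theorem one_div_Gamma_one_sub (s : ℝ) (hs : 0 < s) :
    1 / Real.Gamma (1 - s) = Real.Gamma s * Real.sin (Real.pi * s) / Real.pi := by
  have h := Real.Gamma_mul_Gamma_one_sub s
  have hG := (Real.Gamma_pos_of_pos hs).ne'
  by_cases hsin : Real.sin (Real.pi * s) = 0
  · rw [hsin, div_zero] at h
    rw [hsin, (mul_eq_zero.1 h).resolve_left hG]
    simp
  · have h1 : Real.Gamma (1 - s) ≠ 0 := by
      intro h0
      rw [h0, mul_zero] at h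
      exact div_ne_zero Real.pi_ne_zero hsin h.symm
    rw [eq_div_iff hsin] at h
    rw [div_eq_div_iff h1 Real.pi_ne_zero]
    linarith

-- The imaginary parts carry Γ(βn+1) sin(π(βn+1)), which the reflection formula turns into a
-- reciprocal Gamma value; shifting n by one produces the Wright coefficients and the factor τ.
open Set in
theorem hasSum_mul_wrightFunction {β θ : ℝ} (hβ₀ : 0 < β) (hβ₁ : β < 1) (hθ : Real.pi / 2 < θ)
    (hθ' : θ < Real.pi) (τ : ℝ) :
    HasSum (fun n : ℕ => Real.pi * β * τ *
        ((-τ) ^ n / ((n ! : ℝ) * Real.Gamma (-β * n + (1 - β)))))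
      (∫ r in Ioi (0 : ℝ), rayKernel β τ θ r).im := by
  have h := Complex.hasSum_im (hasSum_integral_rayKernel hβ₀ hβ₁ hθ hθ' τ)
  simp only [Complex.im_ofReal_mul, Complex.exp_ofReal_mul_I_im] at h
  -- The term n = 0 is dropped: it contains sin π = 0.
  rw [← hasSum_nat_add_iff' 1] at h
  simp only [Finset.range_one, Finset.sum_singleton, CharP.cast_eq_zero, mul_zero, zero_add,
    mul_one, Real.sin_pi, sub_zero] at h
  convert! h using 1
  funext n
  have hx : 0 < β * ((n + 1 : ℕ) : ℝ) := by positivity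
  have hn : ((n : ℝ) + 1) ≠ 0 := by positivity
  have hrefl := one_div_Gamma_one_sub (β * ((n + 1 : ℕ) : ℝ)) hx
  rw [show -β * (n : ℝ) + (1 - β) = 1 - β * ((n + 1 : ℕ) : ℝ) by push_cast; ring,
    Real.Gamma_add_one hx.ne', mul_add, mul_one, Real.sin_add_pi]
  have : (-τ) ^ n / ((n ! : ℝ) * Real.Gamma (1 - β * ((n + 1 : ℕ) : ℝ))) =
      (-τ) ^ n / (n ! : ℝ) * (1 / Real.Gamma (1 - β * ((n + 1 : ℕ) : ℝ))) := by
    rw [div_mul_div_comm, mul_one]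
  rw [this, hrefl, Nat.factorial_succ]
  have hpi := Real.pi_ne_zero
  push_cast
  field_simp
  ring

/-- Beyond π/2 the factor e^σ decays, and as long as βθ < π/2 so does e^{-τσ^β} for τ > 0; β < 1
leaves room for both. -/
theorem exists_angle {β : ℝ} (hβ₀ : 0 < β) (hβ₁ : β < 1) :
    ∃ θ : ℝ, Real.pi / 2 < θ ∧ θ < Real.pi ∧ β * θ < Real.pi / 2 := by
  have hpi := Real.pi_pos
  have h1 : Real.pi / 2 < min Real.pi (Real.pi / 2 / β) := by
    refine lt_min (by linarith) ?_
    rw [lt_div_iff₀ hβ₀]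
    nlinarith
  obtain ⟨θ, h2, h3⟩ := exists_between h1
  refine ⟨θ, h2, h3.trans_le (min_le_left _ _), ?_⟩
  have := h3.trans_le (min_le_right _ _)
  rw [lt_div_iff₀ hβ₀] at this
  linarith

/-- Convergence is a by-product of the contour formula at τ = -x, so 1/Γ need not be estimated at
negative arguments. -/
theorem summable_wrightFunction {β : ℝ} (hβ₀ : 0 < β) (hβ₁ : β < 1) (x : ℝ) :
    Summable fun n : ℕ => x ^ n / ((n ! : ℝ) * Real.Gamma (-β * n + (1 - β))) := by
  rcases eq_or_ne x 0 with rfl | hx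
  · refine summable_of_ne_finset_zero (s := {0}) fun n hn => ?_
    rw [zero_pow (by simpa using hn), zero_div]
  · obtain ⟨θ, h1, h2, -⟩ := exists_angle hβ₀ hβ₁
    have h := (hasSum_mul_wrightFunction hβ₀ hβ₁ h1 h2 (-x)).summable
    rw [neg_neg, summable_mul_left_iff (by simp [hx, Real.pi_ne_zero, hβ₀.ne'])] at h
    exact h

open Set in
theorem mul_wrightFunction_eq {β θ : ℝ} (hβ₀ : 0 < β) (hβ₁ : β < 1) (hθ : Real.pi / 2 < θ)
    (hθ' : θ < Real.pi) (τ : ℝ) :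
    Real.pi * β * τ * wrightFunction (-β) (1 - β) (-τ) =
      (∫ r in Ioi (0 : ℝ), rayKernel β τ θ r).im := by
  rw [← (hasSum_mul_wrightFunction hβ₀ hβ₁ hθ hθ' τ).tsum_eq, tsum_mul_left]
  rfl

theorem continuous_wrightFunction {β : ℝ} (hβ₀ : 0 < β) (hβ₁ : β < 1) :
    Continuous (wrightFunction (-β) (1 - β)) := by
  rw [continuous_iff_continuousAt]
  intro x
  have hon : ContinuousOn (wrightFunction (-β) (1 - β)) (Metric.closedBall 0 (|x| + 1)) := by
    refine continuousOn_tsum (fun n => by fun_prop)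
      (summable_wrightFunction hβ₀ hβ₁ (|x| + 1)).norm fun n y hy => ?_
    rw [norm_div, norm_div, norm_pow, norm_pow]
    have : ‖y‖ ≤ ‖|x| + 1‖ := by
      rw [Real.norm_of_nonneg (show 0 ≤ |x| + 1 by positivity)]
      simpa using hy
    gcongr
  refine hon.continuousAt (Metric.closedBall_mem_nhds_of_mem ?_)
  simp

/-! ### Rapid decay of the Wright function. -/

/-- In the left half-plane the Taylor remainders of `exp` are bounded by powers. -/
theorem norm_cexp_sub_sum_le_of_re_nonpos (K : ℕ) {z : ℂ} (hz : z.re ≤ 0) :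
    ‖Complex.exp z - ∑ k ∈ Finset.range K, z ^ k / (k ! : ℂ)‖ ≤ ‖z‖ ^ K := by
  induction K generalizing z with
  | zero => simpa [Complex.norm_exp] using hz
  | succ K ih =>
    set f : ℂ → ℂ := fun z => Complex.exp z - ∑ k ∈ Finset.range (K + 1), z ^ k / (k ! : ℂ) with hf
    have hderiv : ∀ y : ℂ,
        HasDerivAt f (Complex.exp y - ∑ k ∈ Finset.range K, y ^ k / (k ! : ℂ)) y := by
      intro y
      refine (Complex.hasDerivAt_exp y).sub ?_
      have h : HasDerivAt (fun z : ℂ => ∑ k ∈ Finset.range (K + 1), z ^ k / (k ! : ℂ))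
          (∑ k ∈ Finset.range (K + 1), (k : ℂ) * y ^ (k - 1) / (k ! : ℂ)) y :=
        HasDerivAt.fun_sum fun k _ => (hasDerivAt_pow k y).div_const _
      convert! h using 1
      rw [Finset.sum_range_succ']
      simp only [CharP.cast_eq_zero, zero_mul, zero_div, add_zero]
      refine Finset.sum_congr rfl fun k _ => ?_
      have h1 : (k ! : ℂ) ≠ 0 := by exact_mod_cast k.factorial_ne_zero
      have h2 : ((k : ℂ) + 1) ≠ 0 := by exact_mod_cast k.succ_ne_zero
      rw [Nat.factorial_succ, Nat.add_sub_cancel]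
      push_cast
      field_simp
    -- Each remainder is a primitive of the previous one. The mean value inequality is applied on a
    -- half-disc, where `ih` bounds the derivative by ‖z‖^K.
    have hconv : Convex ℝ ({y : ℂ | y.re ≤ 0} ∩ Metric.closedBall 0 ‖z‖) :=
      (convex_halfSpace_re_le 0).inter (convex_closedBall _ _)
    have hb := hconv.norm_image_sub_le_of_norm_hasDerivWithin_le (f := f) (C := ‖z‖ ^ K)
      (x := 0) (y := z) (fun y _ => (hderiv y).hasDerivWithinAt)
      (fun y hy => (ih hy.1).trans (pow_le_pow_left₀ (norm_nonneg _) (by simpa using hy.2) _))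
      (by simp) ⟨hz, by simp⟩
    have h0 : f 0 = 0 := by
      simp [hf, Finset.sum_range_succ']
    rw [h0, sub_zero, sub_zero, ← pow_succ] at hb
    exact hb

section Ray

variable {β θ τ : ℝ}

open Set

theorem integrableOn_pow_mul_cexp_neg_rpow (hβ₀ : 0 < β) (hκ : 0 < Real.cos (β * θ)) (hτ : 0 < τ)
    (k : ℕ) :
    IntegrableOn (fun r : ℝ => (r : ℂ) ^ k *
      Complex.exp (-(τ * (r ^ β : ℝ) * Complex.exp ((β * θ : ℝ) * Complex.I)))) (Ioi 0) := by
  have h := integrableOn_rpow_mul_exp_neg_mul_rpow (s := k) (p := β) (b := τ * Real.cos (β * θ))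
    (lt_of_lt_of_le (by norm_num) (Nat.cast_nonneg k)) hβ₀ (by positivity)
  refine Integrable.mono' h (Measurable.aestronglyMeasurable (by fun_prop)) ?_
  filter_upwards [ae_restrict_mem measurableSet_Ioi] with r hr
  rw [norm_mul, norm_cexp_neg_rpow_mul_cexp, norm_pow, Complex.norm_real,
    Real.norm_of_nonneg (le_of_lt hr), Real.rpow_natCast]
  apply le_of_eq
  ring_nf

/-- The substitution s = r^β gives a Gamma integral with exponent (k+1)/β and rate τe^{iβθ}. -/
theorem integral_pow_mul_cexp_neg_rpow (hβ₀ : 0 < β) (hθ₀ : 0 ≤ θ) (hθ : β * θ < Real.pi / 2)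
    (hτ : 0 < τ) (k : ℕ) :
    ∫ r : ℝ in Ioi 0, (r : ℂ) ^ k *
      Complex.exp (-(τ * (r ^ β : ℝ) * Complex.exp ((β * θ : ℝ) * Complex.I))) =
    ((τ ^ (-((k + 1) / β)) * Real.Gamma ((k + 1) / β) / β : ℝ) : ℂ) *
      Complex.exp (-((k + 1) * θ) * Complex.I) := by
  have ha : 0 < ((k : ℝ) + 1) / β := by positivity
  have h := integral_rpow_mul_cexp_polar_Ioi (ρ := τ) (θ := β * θ) ha hτ
    (by rw [abs_lt]; constructor <;> nlinarith [Real.pi_pos])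
  rw [← integral_comp_rpow_Ioi_of_pos hβ₀] at h
  have hβ : (β : ℂ) ≠ 0 := by exact_mod_cast hβ₀.ne'
  have h2 : ∫ r : ℝ in Ioi 0, (r : ℂ) ^ k *
      Complex.exp (-(τ * (r ^ β : ℝ) * Complex.exp ((β * θ : ℝ) * Complex.I))) =
      ∫ r : ℝ in Ioi 0, (β : ℂ)⁻¹ * ((β * r ^ (β - 1)) •
        ((((r ^ β) ^ (((k : ℝ) + 1) / β - 1) : ℝ) : ℂ) *
        Complex.exp (-(τ * Complex.exp ((β * θ : ℝ) * Complex.I) * (r ^ β : ℝ))))) := by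
    refine setIntegral_congr_fun measurableSet_Ioi fun r hr => ?_
    have hr' : (0 : ℝ) < r := hr
    have h3 : r ^ (β - 1) * (r ^ β) ^ (((k : ℝ) + 1) / β - 1) = r ^ k := by
      rw [← Real.rpow_mul hr'.le, ← Real.rpow_add hr', ← Real.rpow_natCast]
      congr 1
      field_simp
      ring
    have h4 : (((r ^ (β - 1) : ℝ) : ℂ) * (((r ^ β) ^ (((k : ℝ) + 1) / β - 1) : ℝ) : ℂ)) =
        (r : ℂ) ^ k := by
      rw [← Complex.ofReal_mul, h3, Complex.ofReal_pow]
    have h5 : (τ : ℂ) * (r ^ β : ℝ) * Complex.exp ((β * θ : ℝ) * Complex.I) =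
      τ * Complex.exp ((β * θ : ℝ) * Complex.I) * (r ^ β : ℝ) := by ring
    rw [← h4, h5, Complex.real_smul, Complex.ofReal_mul β (r ^ (β - 1))]
    field_simp
  rw [h2, integral_const_mul, h]
  have h6 : (-((((k : ℝ) + 1) / β : ℝ) * (β * θ : ℝ)) : ℂ) = -((k + 1) * θ) := by
    push_cast
    field_simp
  rw [h6]
  push_cast
  field_simp

/-- The Taylor polynomials of the exponential contribute real values along a ray. -/
theorem im_integral_pow_ray_eq_zero (hβ₀ : 0 < β) (hθ₀ : 0 ≤ θ) (hθ : β * θ < Real.pi / 2)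
    (hτ : 0 < τ) (k : ℕ) :
    (∫ r : ℝ in Ioi 0, Complex.exp (θ * Complex.I) *
      (((r * Complex.exp (θ * Complex.I)) ^ k / (k ! : ℂ)) *
      Complex.exp (-(τ * (r ^ β : ℝ) * Complex.exp ((β * θ : ℝ) * Complex.I))))).im = 0 := by
  have h : ∀ r : ℝ, Complex.exp (θ * Complex.I) *
      (((r * Complex.exp (θ * Complex.I)) ^ k / (k ! : ℂ)) *
      Complex.exp (-(τ * (r ^ β : ℝ) * Complex.exp ((β * θ : ℝ) * Complex.I)))) =
      (Complex.exp (((k + 1) * θ) * Complex.I) * ((k ! : ℝ)⁻¹ : ℝ)) * ((r : ℂ) ^ k *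
      Complex.exp (-(τ * (r ^ β : ℝ) * Complex.exp ((β * θ : ℝ) * Complex.I)))) := by
    intro r
    have h1 : Complex.exp (((k + 1) * θ) * Complex.I) =
        Complex.exp (θ * Complex.I) * Complex.exp (θ * Complex.I) ^ k := by
      rw [← pow_succ', ← Complex.exp_nat_mul]
      congr 1
      push_cast
      ring
    rw [h1, mul_pow]
    push_cast
    ring
  simp only [h]
  rw [integral_const_mul, integral_pow_mul_cexp_neg_rpow hβ₀ hθ₀ hθ hτ k]
  -- The phase of σ^k dσ cancels the phase of the Gamma integral.
  have h2 : Complex.exp (((k + 1) * θ) * Complex.I) * Complex.exp (-((k + 1) * θ) * Complex.I) =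
      1 := by
    rw [← Complex.exp_add, neg_mul, add_neg_cancel, Complex.exp_zero]
  have h3 : ∀ a b c d : ℂ, a * b = 1 → a * c * (d * b) = c * d := fun a b c d hab => by
    linear_combination (c * d) * hab
  rw [h3 _ _ _ _ h2, ← Complex.ofReal_mul, Complex.ofReal_im]

/-- The decay comes from e^{-τσ^β} alone, so the vertical ray θ = π/2 is included. -/
theorem integrableOn_rayKernel (hβ₀ : 0 < β) (hcos : Real.cos θ ≤ 0) (hκ : 0 < Real.cos (β * θ))
    (hτ : 0 < τ) : IntegrableOn (rayKernel β τ θ) (Ioi 0) := by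
  have h := integrableOn_rpow_mul_exp_neg_mul_rpow (s := 0) (p := β) (b := τ * Real.cos (β * θ))
    (by norm_num) hβ₀ (by positivity)
  refine Integrable.mono' h (Measurable.aestronglyMeasurable (by unfold rayKernel; fun_prop)) ?_
  filter_upwards [ae_restrict_mem measurableSet_Ioi] with r hr
  rw [norm_rayKernel, Real.rpow_zero]
  have h1 : Real.exp (r * Real.cos θ) ≤ 1 :=
    Real.exp_le_one_iff.2 (mul_nonpos_of_nonneg_of_nonpos (le_of_lt hr) hcos)
  have h2 : -(τ * r ^ β * Real.cos (β * θ)) = -(τ * Real.cos (β * θ)) * r ^ β := by ring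
  rw [h2]
  gcongr

/-- Algebraic decay of arbitrary order of `τ ↦ τ W_{-β,1-β}(-τ)`. -/
theorem abs_im_integral_rayKernel_le (hβ₀ : 0 < β) (hθ₀ : 0 ≤ θ) (hθ : β * θ < Real.pi / 2)
    (hcos : Real.cos θ ≤ 0) (hτ : 0 < τ) (K : ℕ) :
    |(∫ r in Ioi (0 : ℝ), rayKernel β τ θ r).im| ≤
      (τ * Real.cos (β * θ)) ^ (-((K : ℝ) + 1) / β) * (1 / β) *
        Real.Gamma (((K : ℝ) + 1) / β) := by
  have hκ : 0 < Real.cos (β * θ) := by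
    apply Real.cos_pos_of_mem_Ioo
    constructor <;> nlinarith [Real.pi_pos]
  set E : ℝ → ℂ := fun r =>
    Complex.exp (-(τ * (r ^ β : ℝ) * Complex.exp ((β * θ : ℝ) * Complex.I))) with hE
  set T : ℕ → ℝ → ℂ := fun k r => Complex.exp (θ * Complex.I) *
      (((r * Complex.exp (θ * Complex.I)) ^ k / (k ! : ℂ)) * E r) with hT
  have hTint : ∀ k, IntegrableOn (T k) (Ioi 0) := by
    intro k
    refine ((integrableOn_pow_mul_cexp_neg_rpow hβ₀ hκ hτ k).const_mul
      (Complex.exp (θ * Complex.I) * (Complex.exp (θ * Complex.I) ^ k / (k ! : ℂ)))).congr ?_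
    refine ae_of_all _ fun r => ?_
    simp only [hT, hE, mul_pow]
    ring
  have hsumint : IntegrableOn (fun r => ∑ k ∈ Finset.range K, T k r) (Ioi 0) :=
    integrable_finsetSum _ fun k _ => hTint k
  have hKint := integrableOn_rayKernel hβ₀ hcos hκ hτ
  -- Subtracting Taylor terms of e^σ leaves the imaginary part unchanged, and the remainder
  -- contributes a factor r^K.
  have him : (∫ r in Ioi (0 : ℝ), rayKernel β τ θ r).im =
      (∫ r in Ioi (0 : ℝ), (rayKernel β τ θ r - ∑ k ∈ Finset.range K, T k r)).im := by
    rw [integral_sub hKint hsumint, integral_finsetSum _ fun k _ => hTint k, Complex.sub_im,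
      Complex.im_sum, Finset.sum_eq_zero fun k _ => im_integral_pow_ray_eq_zero hβ₀ hθ₀ hθ hτ k,
      sub_zero]
  rw [him, ← integral_rpow_mul_exp_neg_mul_rpow (q := K) (b := τ * Real.cos (β * θ)) hβ₀
    (lt_of_lt_of_le (by norm_num) (Nat.cast_nonneg K)) (by positivity)]
  refine (Complex.abs_im_le_norm _).trans (norm_integral_le_of_norm_le
    (integrableOn_rpow_mul_exp_neg_mul_rpow (lt_of_lt_of_le (by norm_num) (Nat.cast_nonneg K)) hβ₀
      (by positivity)) ?_)
  filter_upwards [ae_restrict_mem measurableSet_Ioi] with r hr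
  have hr' : (0 : ℝ) < r := hr
  have h1 : rayKernel β τ θ r - ∑ k ∈ Finset.range K, T k r = Complex.exp (θ * Complex.I) *
      ((Complex.exp (r * Complex.exp (θ * Complex.I)) -
        ∑ k ∈ Finset.range K, (r * Complex.exp (θ * Complex.I)) ^ k / (k ! : ℂ)) * E r) := by
    rw [sub_mul, mul_sub, Finset.sum_mul, Finset.mul_sum]
    rfl
  have hre : ((r : ℂ) * Complex.exp (θ * Complex.I)).re ≤ 0 := by
    rw [Complex.re_ofReal_mul, Complex.exp_ofReal_mul_I_re]
    exact mul_nonpos_of_nonneg_of_nonpos hr'.le hcos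
  have h2 := norm_cexp_sub_sum_le_of_re_nonpos K hre
  rw [norm_mul, Complex.norm_exp_ofReal_mul_I, mul_one, Complex.norm_real,
    Real.norm_of_nonneg hr'.le] at h2
  rw [h1, norm_mul, Complex.norm_exp_ofReal_mul_I, one_mul, norm_mul, norm_cexp_neg_rpow_mul_cexp,
    Real.rpow_natCast, show -(τ * Real.cos (β * θ)) * r ^ β = -(τ * r ^ β * Real.cos (β * θ)) by
      ring]
  gcongr

end Ray

/-! ### Mellin transform of the ray integral. -/

section Mellin

variable {β θ p : ℝ}

open Set

theorem integrable_rpow_mul_rayKernel_prod (hβ₀ : 0 < β) (hβ₁ : β < 1) (hcos : Real.cos θ < 0)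
    (hκ : 0 < Real.cos (β * θ)) (hp₀ : 0 < p) (hp₁ : p < 1) :
    Integrable (fun x : ℝ × ℝ => ((x.1 ^ (p - 1) : ℝ) : ℂ) * rayKernel β x.1 θ x.2)
      ((volume.restrict (Ioi 0)).prod (volume.restrict (Ioi 0))) := by
  have hmeas : Measurable fun x : ℝ × ℝ => ((x.1 ^ (p - 1) : ℝ) : ℂ) * rayKernel β x.1 θ x.2 := by
    unfold rayKernel
    fun_prop
  have hnorm : ∀ τ r : ℝ, 0 < τ → ‖((τ ^ (p - 1) : ℝ) : ℂ) * rayKernel β τ θ r‖ =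
      Real.exp (r * Real.cos θ) *
        (τ ^ (p - 1) * Real.exp (-(r ^ β * Real.cos (β * θ) * τ))) := by
    intro τ r hτ
    rw [norm_mul, norm_rayKernel, Complex.norm_real, Real.norm_of_nonneg (by positivity)]
    ring_nf
  rw [integrable_prod_iff' hmeas.aestronglyMeasurable]
  constructor
  · filter_upwards [ae_restrict_mem measurableSet_Ioi] with r hr
    have hr' : (0 : ℝ) < r := hr
    have h := (integrableOn_rpow_mul_exp_neg_mul_rpow (p := 1) (s := p - 1)
      (b := r ^ β * Real.cos (β * θ)) (by linarith) one_pos (by positivity)).const_mul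
      (Real.exp (r * Real.cos θ))
    refine Integrable.mono' h (hmeas.comp measurable_prodMk_right).aestronglyMeasurable ?_
    filter_upwards [ae_restrict_mem measurableSet_Ioi] with τ hτ
    rw [hnorm τ r hτ, Real.rpow_one, neg_mul]
  -- The inner integral of the norm is a constant times r^{-βp} e^{r cos θ}; integrability at 0
  -- requires βp < 1.
  · have h := (integrableOn_rpow_mul_exp_neg_mul_rpow (p := 1) (s := -(β * p))
      (b := -Real.cos θ) (by nlinarith) one_pos (by linarith)).const_mul
      (Real.cos (β * θ) ^ (-p) * Real.Gamma p)
    refine h.congr ?_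
    filter_upwards [ae_restrict_mem measurableSet_Ioi] with r hr
    have hr' : (0 : ℝ) < r := hr
    have h1 : ∫ τ in Ioi (0 : ℝ), ‖((τ ^ (p - 1) : ℝ) : ℂ) * rayKernel β τ θ r‖ =
        ∫ τ in Ioi (0 : ℝ), Real.exp (r * Real.cos θ) *
          (τ ^ (p - 1) * Real.exp (-(r ^ β * Real.cos (β * θ) * τ))) :=
      setIntegral_congr_fun measurableSet_Ioi fun τ hτ => hnorm τ r hτ
    rw [h1, integral_const_mul, Real.integral_rpow_mul_exp_neg_mul_Ioi hp₀ (by positivity),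
      one_div, Real.inv_rpow (by positivity), ← Real.rpow_neg (by positivity),
      Real.mul_rpow (by positivity) hκ.le, ← Real.rpow_mul hr'.le, Real.rpow_one, neg_neg,
      mul_neg, mul_comm (Real.cos θ) r]
    ring

/-- By Fubini, the τ-integral is a Gamma integral giving Γ(p) σ^{-βp}, and the remaining r-integral
is one of exponent 1 - βp. Reflection converts Γ(1-βp) sin(π(1-βp)) into π/Γ(βp). -/
theorem integral_rpow_mul_im_rayKernel (hβ₀ : 0 < β) (hβ₁ : β < 1) (hθ : Real.pi / 2 < θ)
    (hθ' : θ < Real.pi) (hβθ : β * θ < Real.pi / 2) (hp₀ : 0 < p) (hp₁ : p < 1) :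
    ∫ τ in Ioi (0 : ℝ), τ ^ (p - 1) * (∫ r in Ioi (0 : ℝ), rayKernel β τ θ r).im =
      Real.pi * (Real.Gamma p / Real.Gamma (β * p)) := by
  have hpi := Real.pi_pos
  have hcos : Real.cos θ < 0 := Real.cos_neg_of_pi_div_two_lt_of_lt hθ (by linarith)
  have hβθ' : |β * θ| < Real.pi / 2 := by
    rw [abs_lt]
    constructor <;> nlinarith
  have hκ : 0 < Real.cos (β * θ) := by
    rw [abs_lt] at hβθ'
    exact Real.cos_pos_of_mem_Ioo hβθ'
  have hβp : β * p < 1 := by nlinarith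
  have hint := integrable_rpow_mul_rayKernel_prod hβ₀ hβ₁ hcos hκ hp₀ hp₁
  have hswap := integral_integral_swap (f := fun τ r => ((τ ^ (p - 1) : ℝ) : ℂ) *
    rayKernel β τ θ r) hint
  have hleft : (∫ τ in Ioi (0 : ℝ), ∫ r in Ioi (0 : ℝ), ((τ ^ (p - 1) : ℝ) : ℂ) *
      rayKernel β τ θ r).im =
      ∫ τ in Ioi (0 : ℝ), τ ^ (p - 1) * (∫ r in Ioi (0 : ℝ), rayKernel β τ θ r).im := by
    have h := integral_im (𝕜 := ℂ) hint.integral_prod_left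
    simp only [RCLike.im_to_complex] at h
    rw [← h]
    refine integral_congr_ae (ae_of_all _ fun τ => ?_)
    simp only [integral_const_mul, Complex.im_ofReal_mul]
  have hinner : ∀ r : ℝ, 0 < r → ∫ τ in Ioi (0 : ℝ), ((τ ^ (p - 1) : ℝ) : ℂ) *
      rayKernel β τ θ r = (Complex.exp (θ * Complex.I) * ((Real.Gamma p : ℝ) : ℂ) *
        Complex.exp (-(p * (β * θ : ℝ)) * Complex.I)) * (((r ^ (1 - β * p - 1) : ℝ) : ℂ) *
        Complex.exp (-((1 : ℝ) * Complex.exp ((θ - Real.pi : ℝ) * Complex.I) * r))) := by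
    intro r hr
    have h1 := integral_rpow_mul_cexp_polar_Ioi (a := p) (ρ := r ^ β) (θ := β * θ) hp₀
      (by positivity) hβθ'
    have h2 : ∀ τ : ℝ, ((τ ^ (p - 1) : ℝ) : ℂ) * rayKernel β τ θ r =
        (Complex.exp (θ * Complex.I) * Complex.exp (r * Complex.exp (θ * Complex.I))) *
        (((τ ^ (p - 1) : ℝ) : ℂ) * Complex.exp (-((r ^ β : ℝ) *
          Complex.exp ((β * θ : ℝ) * Complex.I) * τ))) := by
      intro τ
      rw [rayKernel, show (τ : ℂ) * (r ^ β : ℝ) * Complex.exp ((β * θ : ℝ) * Complex.I) =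
        (r ^ β : ℝ) * Complex.exp ((β * θ : ℝ) * Complex.I) * τ by ring]
      ring
    have h3 : (r : ℂ) * Complex.exp (θ * Complex.I) =
        -((1 : ℝ) * Complex.exp ((θ - Real.pi : ℝ) * Complex.I) * r) := by
      rw [cexp_mul_I_eq_neg_cexp_sub_pi]; push_cast; ring
    simp only [h2]
    rw [integral_const_mul, h1, ← Real.rpow_mul hr.le, h3,
      show 1 - β * p - 1 = β * -p by ring]
    push_cast
    ring
  rw [← hleft, hswap, setIntegral_congr_fun measurableSet_Ioi fun r hr => hinner r hr,
    integral_const_mul, integral_rpow_mul_cexp_polar_Ioi (a := 1 - β * p) (by linarith) one_pos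
      (by rw [abs_lt]; constructor <;> linarith), Real.one_rpow, one_mul]
  have hE : Complex.exp (θ * Complex.I) * ((Real.Gamma p : ℝ) : ℂ) *
        Complex.exp (-(p * (β * θ : ℝ)) * Complex.I) * (((Real.Gamma (1 - β * p) : ℝ) : ℂ) *
        Complex.exp (-(((1 - β * p : ℝ) : ℂ) * ((θ - Real.pi : ℝ) : ℂ)) * Complex.I)) =
      ((Real.Gamma p * Real.Gamma (1 - β * p) : ℝ) : ℂ) *
        Complex.exp ((Real.pi * (1 - β * p) : ℝ) * Complex.I) := by
    have : Complex.exp ((Real.pi * (1 - β * p) : ℝ) * Complex.I) =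
        Complex.exp (θ * Complex.I) * Complex.exp (-(p * (β * θ : ℝ)) * Complex.I) *
        Complex.exp (-(((1 - β * p : ℝ) : ℂ) * ((θ - Real.pi : ℝ) : ℂ)) * Complex.I) := by
      rw [← Complex.exp_add, ← Complex.exp_add]
      congr 1
      push_cast
      ring
    rw [this]
    push_cast
    ring
  rw [hE, Complex.im_ofReal_mul, Complex.exp_ofReal_mul_I_im]
  have h := one_div_Gamma_one_sub (1 - β * p) (by linarith)
  rw [sub_sub_cancel] at h
  rw [div_eq_mul_one_div (Real.Gamma p), h]
  field_simp

end Mellin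

/-! ### Moments of the mixing density. -/

section Moments

variable {β : ℝ}

open Set Filter Topology Asymptotics

theorem wrightFunction_isBigO_atTop (hβ₀ : 0 < β) (hβ₁ : β < 1) (a : ℝ) :
    (fun τ : ℝ => ((wrightFunction (-β) (1 - β) (-τ) : ℝ) : ℂ)) =O[atTop] (· ^ (-a)) := by
  obtain ⟨θ, h1, h2, h3⟩ := exists_angle hβ₀ hβ₁
  have hpi := Real.pi_pos
  have hcos : Real.cos θ ≤ 0 := (Real.cos_neg_of_pi_div_two_lt_of_lt h1 (by linarith)).le
  have hκ : 0 < Real.cos (β * θ) := Real.cos_pos_of_mem_Ioo ⟨by nlinarith, h3⟩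
  -- The decay rate obtained from K Taylor terms is τ^{-(K+1)/β}, so K > aβ suffices.
  obtain ⟨K, hK⟩ := exists_nat_gt (a * β)
  set C : ℝ := Real.cos (β * θ) ^ (-((K : ℝ) + 1) / β) * (1 / β) *
    Real.Gamma (((K : ℝ) + 1) / β) with hC
  refine IsBigO.of_bound (C / (Real.pi * β)) ?_
  filter_upwards [eventually_ge_atTop 1] with τ hτ
  have hτ₀ : 0 < τ := by linarith
  have h := abs_im_integral_rayKernel_le (K := K) hβ₀ (by linarith) h3 hcos hτ₀
  rw [← mul_wrightFunction_eq hβ₀ hβ₁ h1 h2, abs_mul, abs_of_pos (by positivity),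
    Real.mul_rpow hτ₀.le hκ.le] at h
  rw [Complex.norm_real, Real.norm_eq_abs, Real.norm_of_nonneg (by positivity), div_mul_eq_mul_div,
    le_div_iff₀ (by positivity)]
  have h4 : τ ^ (-((K : ℝ) + 1) / β) ≤ τ ^ (-a) := by
    apply Real.rpow_le_rpow_of_exponent_le hτ
    rw [div_le_iff₀ hβ₀]
    linarith
  have hC₀ : 0 ≤ C := by
    have := Real.Gamma_pos_of_pos (show 0 < ((K : ℝ) + 1) / β by positivity)
    positivity
  calc |wrightFunction (-β) (1 - β) (-τ)| * (Real.pi * β)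
      ≤ |wrightFunction (-β) (1 - β) (-τ)| * (Real.pi * β) * τ :=
        le_mul_of_one_le_right (by positivity) hτ
    _ = Real.pi * β * τ * |wrightFunction (-β) (1 - β) (-τ)| := by ring
    _ ≤ τ ^ (-((K : ℝ) + 1) / β) * C := by
        refine h.trans (le_of_eq ?_)
        rw [hC]
        ring
    _ ≤ C * τ ^ (-a) := by
        rw [mul_comm]
        gcongr

theorem wrightFunction_isBigO_zero (hβ₀ : 0 < β) (hβ₁ : β < 1) :
    (fun τ : ℝ => ((wrightFunction (-β) (1 - β) (-τ) : ℝ) : ℂ)) =O[𝓝[>] 0]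
      (· ^ (-(0 : ℝ))) := by
  have hc : Continuous fun τ : ℝ => ((wrightFunction (-β) (1 - β) (-τ) : ℝ) : ℂ) :=
    Complex.continuous_ofReal.comp ((continuous_wrightFunction hβ₀ hβ₁).comp continuous_neg)
  simp only [neg_zero, Real.rpow_zero]
  exact ((hc.tendsto 0).isBigO_one ℝ).mono nhdsWithin_le_nhds

theorem locallyIntegrableOn_wrightFunction (hβ₀ : 0 < β) (hβ₁ : β < 1) :
    LocallyIntegrableOn (fun τ : ℝ => ((wrightFunction (-β) (1 - β) (-τ) : ℝ) : ℂ)) (Ioi 0) :=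
  (Complex.continuous_ofReal.comp ((continuous_wrightFunction hβ₀ hβ₁).comp
    continuous_neg)).locallyIntegrable.locallyIntegrableOn _

/-- The factor τ in the contour formula shifts the exponent, so p = s - 1; the range p ∈ (0, 1)
allowed by Fubini becomes s ∈ (1, 2). -/
theorem mellin_wrightFunction_of_mem_Ioo (hβ₀ : 0 < β) (hβ₁ : β < 1) {s : ℝ}
    (hs : s ∈ Ioo (1 : ℝ) 2) :
    mellin (fun τ : ℝ => ((wrightFunction (-β) (1 - β) (-τ) : ℝ) : ℂ)) s =
      Complex.Gamma s * (Complex.Gamma (1 - β + β * s))⁻¹ := by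
  obtain ⟨θ, h1, h2, h3⟩ := exists_angle hβ₀ hβ₁
  have h := integral_rpow_mul_im_rayKernel (p := s - 1) hβ₀ hβ₁ h1 h2 h3 (by linarith [hs.1])
    (by linarith [hs.2])
  have hs1 : 0 < s - 1 := by linarith [hs.1]
  have hreal : ∫ τ in Ioi (0 : ℝ), τ ^ (s - 1) * wrightFunction (-β) (1 - β) (-τ) =
      Real.Gamma s * (Real.Gamma (1 - β + β * s))⁻¹ := by
    have h4 : ∫ τ in Ioi (0 : ℝ), τ ^ (s - 1 - 1) * (∫ r in Ioi (0 : ℝ), rayKernel β τ θ r).im =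
        ∫ τ in Ioi (0 : ℝ), (Real.pi * β) *
          (τ ^ (s - 1) * wrightFunction (-β) (1 - β) (-τ)) := by
      refine setIntegral_congr_fun measurableSet_Ioi fun τ hτ => ?_
      have hτ' : (0 : ℝ) < τ := hτ
      have h5 : τ ^ (s - 1 - 1) * τ = τ ^ (s - 1) := by
        rw [← Real.rpow_add_one hτ'.ne', sub_add_cancel]
      rw [← mul_wrightFunction_eq hβ₀ hβ₁ h1 h2, ← h5]
      ring
    rw [h4, integral_const_mul] at h
    have hpos : 0 < β * (s - 1) := by positivity
    rw [show s = (s - 1) + 1 by ring, Real.Gamma_add_one hs1.ne',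
      show 1 - β + β * (s - 1 + 1) = β * (s - 1) + 1 by ring, Real.Gamma_add_one hpos.ne',
      add_sub_cancel_right]
    have hpi := Real.pi_ne_zero
    have hG := (Real.Gamma_pos_of_pos hpos).ne'
    field_simp at h ⊢
    linarith
  have h6 := congrArg (fun x : ℝ => (x : ℂ)) hreal
  simp only [← integral_complex_ofReal, Complex.ofReal_mul, Complex.ofReal_inv,
    ← Complex.Gamma_ofReal] at h6
  push_cast at h6
  rw [← h6, mellin]
  refine setIntegral_congr_fun measurableSet_Ioi fun τ hτ => ?_
  simp only [smul_eq_mul]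
  rw [Complex.ofReal_cpow (le_of_lt hτ)]
  push_cast
  rfl

/-- The Mellin transform of `τ ↦ W_{-β,1-β}(-τ)` in the right half-plane. -/
theorem mellin_wrightFunction (hβ₀ : 0 < β) (hβ₁ : β < 1) {s : ℂ} (hs : 0 < s.re) :
    mellin (fun τ : ℝ => ((wrightFunction (-β) (1 - β) (-τ) : ℝ) : ℂ)) s =
      Complex.Gamma s * (Complex.Gamma (1 - β + β * s))⁻¹ := by
  have hUo : IsOpen {z : ℂ | 0 < z.re} := isOpen_lt continuous_const Complex.continuous_re
  have h1 : AnalyticOnNhd ℂ (mellin fun τ : ℝ =>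
      ((wrightFunction (-β) (1 - β) (-τ) : ℝ) : ℂ)) {z : ℂ | 0 < z.re} := by
    refine DifferentiableOn.analyticOnNhd (fun z hz => ?_) hUo
    exact (mellin_differentiableAt_of_isBigO_rpow (a := z.re + 1) (b := 0)
      (locallyIntegrableOn_wrightFunction hβ₀ hβ₁) (wrightFunction_isBigO_atTop hβ₀ hβ₁ _)
      (by linarith) (wrightFunction_isBigO_zero hβ₀ hβ₁) hz).differentiableWithinAt
  have h2 : AnalyticOnNhd ℂ (fun s : ℂ => Complex.Gamma s * (Complex.Gamma (1 - β + β * s))⁻¹)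
      {z : ℂ | 0 < z.re} := by
    refine DifferentiableOn.analyticOnNhd (fun z hz => ?_) hUo
    refine DifferentiableAt.differentiableWithinAt (DifferentiableAt.mul ?_ ?_)
    · refine Complex.differentiableAt_Gamma _ fun m hm => ?_
      have : (0 : ℝ) < z.re := hz
      rw [hm] at this
      simp at this
      linarith [(Nat.cast_nonneg m : (0 : ℝ) ≤ m)]
    · exact (Complex.differentiable_one_div_Gamma.comp
        (show Differentiable ℂ fun s : ℂ => 1 - (β : ℂ) + β * s by fun_prop)) z
  have hconn : IsPreconnected {z : ℂ | 0 < z.re} :=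
    (convex_halfSpace_re_gt 0).isPreconnected
  -- Identity theorem again, from real points of (1, 2) accumulating at 3/2.
  refine h1.eqOn_of_preconnected_of_frequently_eq h2 hconn (z₀ := ((3 / 2 : ℝ) : ℂ))
    (by show (0 : ℝ) < (((3 / 2 : ℝ) : ℂ)).re; rw [Complex.ofReal_re]; norm_num) ?_ hs
  have hf : ∃ᶠ x : ℝ in 𝓝[≠] (3 / 2 : ℝ), x ∈ Ioo (1 : ℝ) 2 := by
    refine Filter.Eventually.frequently ?_
    exact eventually_nhdsWithin_of_eventually_nhds
      (Ioo_mem_nhds (by norm_num) (by norm_num))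
  have ht : Tendsto (fun x : ℝ => (x : ℂ)) (𝓝[≠] (3 / 2 : ℝ)) (𝓝[≠] ((3 / 2 : ℝ) : ℂ)) := by
    refine tendsto_nhdsWithin_of_tendsto_nhds_of_eventually_within _ ?_ ?_
    · exact (Complex.continuous_ofReal.tendsto _).mono_left nhdsWithin_le_nhds
    · filter_upwards [self_mem_nhdsWithin] with x hx
      simpa only [mem_compl_iff, mem_singleton_iff, Complex.ofReal_inj] using hx
  exact ht.frequently (hf.mono fun x hx => mellin_wrightFunction_of_mem_Ioo hβ₀ hβ₁ hx)

theorem integrableOn_pow_mul_wrightFunction (hβ₀ : 0 < β) (hβ₁ : β < 1) (n : ℕ) :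
    IntegrableOn (fun τ : ℝ => τ ^ n * wrightFunction (-β) (1 - β) (-τ)) (Ioi 0) := by
  have h : MellinConvergent (fun τ : ℝ => ((wrightFunction (-β) (1 - β) (-τ) : ℝ) : ℂ))
      ((n : ℂ) + 1) :=
    mellinConvergent_of_isBigO_rpow (a := n + 2) (b := 0)
      (locallyIntegrableOn_wrightFunction hβ₀ hβ₁) (wrightFunction_isBigO_atTop hβ₀ hβ₁ _)
      (by simp) (wrightFunction_isBigO_zero hβ₀ hβ₁) (by simp; positivity)
  have h' := Integrable.re h
  refine h'.congr ?_
  refine ae_of_all _ fun τ => ?_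
  simp only [add_sub_cancel_right, Complex.cpow_natCast, smul_eq_mul]
  rw [← Complex.ofReal_pow, ← Complex.ofReal_mul]
  exact Complex.ofReal_re _

/-- The Mellin transform at s = n + 1, where 1 - β + βs = βn + 1. -/
theorem integral_pow_mul_wrightFunction (hβ₀ : 0 < β) (hβ₁ : β < 1) (n : ℕ) :
    ∫ τ in Ioi (0 : ℝ), τ ^ n * wrightFunction (-β) (1 - β) (-τ) =
      (n ! : ℝ) / Real.Gamma (β * n + 1) := by
  have h := mellin_wrightFunction hβ₀ hβ₁ (s := n + 1) (by simp; positivity)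
  rw [mellin, Complex.Gamma_nat_eq_factorial] at h
  rw [← Complex.ofReal_inj, ← integral_complex_ofReal, Complex.ofReal_div, ← Complex.Gamma_ofReal,
    div_eq_mul_inv]
  convert! h using 1
  · refine integral_congr_ae (ae_of_all _ fun τ => ?_)
    simp
  · push_cast
    ring_nf

end Moments

/-! ### Power series with nonnegative coefficients. -/

section AbsolutelyMonotone

open Filter Topology

theorem re_one_sub_mul_pos {c : ℝ} (hc : 0 < c) {z : ℂ} (hz : ‖z‖ < 1) :
    0 < ((1 - z) * (c : ℂ)).re := by
  have h1 : z.re < 1 := (Complex.re_le_norm z).trans_lt hz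
  rw [Complex.re_mul_ofReal, Complex.sub_re, Complex.one_re]
  exact mul_pos (by linarith) hc

theorem hasDerivAt_one_sub_mul_cpow {c : ℝ} (hc : 0 < c) (γ : ℝ) {z : ℂ} (hz : ‖z‖ < 1) :
    HasDerivAt (fun z : ℂ => ((1 - z) * (c : ℂ)) ^ (γ : ℂ))
      (((-(γ * c) : ℝ) : ℂ) * ((1 - z) * (c : ℂ)) ^ ((γ - 1 : ℝ) : ℂ)) z := by
  have h1 : HasDerivAt (fun z : ℂ => (1 - z) * (c : ℂ)) (-1 * (c : ℂ)) z := by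
    simpa using ((hasDerivAt_id z).const_sub 1).mul_const (c : ℂ)
  convert! h1.cpow_const (c := (γ : ℂ)) (Or.inl (re_one_sub_mul_pos hc hz)) using 1
  push_cast
  ring

theorem contDiffAt_one_sub_mul_cpow {c : ℝ} (hc : 0 < c) (γ : ℝ) (n : WithTop ℕ∞) :
    ContDiffAt ℂ n (fun z : ℂ => ((1 - z) * (c : ℂ)) ^ (γ : ℂ)) 0 := by
  refine AnalyticAt.contDiffAt ?_
  refine AnalyticAt.cpow (by fun_prop) (by fun_prop) ?_
  exact Or.inl (re_one_sub_mul_pos hc (by simp))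

theorem eventually_norm_lt_one : ∀ᶠ z : ℂ in 𝓝 0, ‖z‖ < 1 := by
  filter_upwards [Metric.ball_mem_nhds (0 : ℂ) one_pos] with z hz using by simpa using hz

/-- Differentiation produces the factor -γc ≥ 0 and lowers the exponent, which therefore stays
nonpositive. -/
theorem iteratedDeriv_one_sub_mul_cpow_nonneg {c : ℝ} (hc : 0 < c) (k : ℕ) {γ : ℝ} (hγ : γ ≤ 0) :
    0 ≤ iteratedDeriv k (fun z : ℂ => ((1 - z) * (c : ℂ)) ^ (γ : ℂ)) 0 := by
  induction k generalizing γ with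
  | zero =>
    rw [iteratedDeriv_zero, sub_zero, one_mul, ← Complex.ofReal_cpow hc.le]
    exact Complex.zero_le_real.2 (by positivity)
  | succ k ih =>
    have h : deriv (fun z : ℂ => ((1 - z) * (c : ℂ)) ^ (γ : ℂ)) =ᶠ[𝓝 0]
        fun z => ((-(γ * c) : ℝ) : ℂ) * ((1 - z) * (c : ℂ)) ^ ((γ - 1 : ℝ) : ℂ) := by
      filter_upwards [eventually_norm_lt_one] with z hz
      exact (hasDerivAt_one_sub_mul_cpow hc γ hz).deriv
    rw [iteratedDeriv_succ', h.iteratedDeriv_eq, iteratedDeriv_const_mul_field]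
    exact mul_nonneg (Complex.zero_le_real.2 (by nlinarith)) (ih (by linarith))

variable {β τ c : ℝ}

theorem hasDerivAt_cexp_neg_mul_cpow (hc : 0 < c) {z : ℂ} (hz : ‖z‖ < 1) :
    HasDerivAt (fun z : ℂ => Complex.exp (-(τ * ((1 - z) * (c : ℂ)) ^ (β : ℂ))))
      (((τ * (β * c) : ℝ) : ℂ) * (((1 - z) * (c : ℂ)) ^ ((β - 1 : ℝ) : ℂ) *
        Complex.exp (-(τ * ((1 - z) * (c : ℂ)) ^ (β : ℂ))))) z := by
  convert! ((hasDerivAt_one_sub_mul_cpow hc β hz).const_mul (τ : ℂ)).fun_neg.cexp using 1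
  push_cast
  ring

theorem contDiffAt_cexp_neg_mul_cpow (hc : 0 < c) (n : WithTop ℕ∞) :
    ContDiffAt ℂ n (fun z : ℂ => Complex.exp (-(τ * ((1 - z) * (c : ℂ)) ^ (β : ℂ)))) 0 :=
  ((contDiffAt_const.mul (contDiffAt_one_sub_mul_cpow hc β n)).neg).cexp

/-- `exp (-τ (c (1 - z)) ^ β)` has nonnegative Taylor coefficients at `0`. -/
theorem iteratedDeriv_cexp_neg_mul_cpow_nonneg (hβ₀ : 0 < β) (hβ₁ : β < 1) (hτ : 0 < τ)
    (hc : 0 < c) (k : ℕ) :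
    0 ≤ iteratedDeriv k
      (fun z : ℂ => Complex.exp (-(τ * ((1 - z) * (c : ℂ)) ^ (β : ℂ)))) 0 := by
  induction k using Nat.strong_induction_on with
  | _ k ih =>
    cases k with
    | zero =>
      rw [iteratedDeriv_zero, sub_zero, one_mul, ← Complex.ofReal_cpow hc.le, ← Complex.ofReal_mul,
        ← Complex.ofReal_neg, ← Complex.ofReal_exp]
      exact Complex.zero_le_real.2 (by positivity)
    | succ k =>
      have h : deriv (fun z : ℂ => Complex.exp (-(τ * ((1 - z) * (c : ℂ)) ^ (β : ℂ)))) =ᶠ[𝓝 0]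
          fun z => ((τ * (β * c) : ℝ) : ℂ) * (((1 - z) * (c : ℂ)) ^ ((β - 1 : ℝ) : ℂ) *
            Complex.exp (-(τ * ((1 - z) * (c : ℂ)) ^ (β : ℂ)))) := by
        filter_upwards [eventually_norm_lt_one] with z hz
        exact (hasDerivAt_cexp_neg_mul_cpow hc hz).deriv
      -- The function G satisfies G' = τβc (c(1-z))^{β-1} G with β - 1 < 0. The Leibniz rule
      -- involves all lower derivatives of G, hence the strong induction.
      rw [iteratedDeriv_succ', h.iteratedDeriv_eq, iteratedDeriv_const_mul_field,
        iteratedDeriv_fun_mul (contDiffAt_one_sub_mul_cpow hc _ _)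
          (contDiffAt_cexp_neg_mul_cpow hc _)]
      refine mul_nonneg (Complex.zero_le_real.2 (by positivity)) (Finset.sum_nonneg fun i _ => ?_)
      refine mul_nonneg (mul_nonneg (Nat.cast_nonneg _) ?_) (ih _ (by omega))
      exact iteratedDeriv_one_sub_mul_cpow_nonneg hc i (by linarith)

theorem exists_hasSum_cexp_neg_mul_cpow (hβ₀ : 0 < β) (hβ₁ : β < 1) (hτ : 0 < τ) (hc : 0 < c) :
    ∃ a : ℕ → ℝ, (∀ k, 0 ≤ a k) ∧ ∀ z : ℂ, ‖z‖ < 1 →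
      HasSum (fun k => (a k : ℂ) * z ^ k)
        (Complex.exp (-(τ * ((1 - z) * (c : ℂ)) ^ (β : ℂ)))) := by
  have hnn := iteratedDeriv_cexp_neg_mul_cpow_nonneg hβ₀ hβ₁ hτ hc
  set G : ℂ → ℂ := fun z => Complex.exp (-(τ * ((1 - z) * (c : ℂ)) ^ (β : ℂ))) with hG
  refine ⟨fun k => (k ! : ℝ)⁻¹ * (iteratedDeriv k G 0).re, fun k => ?_, fun z hz => ?_⟩
  · exact mul_nonneg (by positivity) (Complex.nonneg_iff.1 (hnn k)).1
  · have hd : DifferentiableOn ℂ G (Metric.ball 0 1) := fun y hy =>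
      (hasDerivAt_cexp_neg_mul_cpow hc (by simpa using hy)).differentiableAt.differentiableWithinAt
    convert! Complex.hasSum_taylorSeries_on_ball hd (z := z) (by simpa using hz) using 1
    funext k
    have h := (Complex.eq_re_of_ofReal_le (hnn k))
    rw [smul_eq_mul, smul_eq_mul, sub_zero]
    conv_rhs => rw [h]
    push_cast
    ring

end AbsolutelyMonotone

/-! ### Nonnegativity of the density. -/

section Positivity

open Set Filter Topology

/-- The real part of the integrand is even, so this is half of the full Fourier integral of a
Gaussian, which is positive. -/
theorem re_integral_cexp_mul_gaussian_nonneg (b : ℝ) {v : ℝ} (hv : 0 < v) :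
    0 ≤ (∫ y in Ioi (0 : ℝ), Complex.exp ((b * y : ℝ) * Complex.I) *
      ((Real.exp (-v * y ^ 2) : ℝ) : ℂ)).re := by
  have hbound : Integrable fun y : ℝ => Real.exp (-v * y ^ 2) := integrable_exp_neg_mul_sq hv
  have hint : Integrable fun y : ℝ => Complex.exp ((b * y : ℝ) * Complex.I) *
      ((Real.exp (-v * y ^ 2) : ℝ) : ℂ) := by
    refine hbound.mono' (by fun_prop) (ae_of_all _ fun y => ?_)
    rw [norm_mul, Complex.norm_exp_ofReal_mul_I, one_mul, Complex.norm_real,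
      Real.norm_of_nonneg (Real.exp_pos _).le]
  have hre : ∀ y : ℝ, RCLike.re (Complex.exp ((b * y : ℝ) * Complex.I) *
      ((Real.exp (-v * y ^ 2) : ℝ) : ℂ)) = Real.cos (b * y) * Real.exp (-v * y ^ 2) := by
    intro y
    rw [RCLike.re_to_complex, Complex.re_mul_ofReal, Complex.exp_ofReal_mul_I_re]
  have h1 := integral_re (𝕜 := ℂ) hint.integrableOn (μ := volume.restrict (Ioi 0))
  have h2 := integral_re (𝕜 := ℂ) hint
  simp only [hre] at h1 h2
  rw [← RCLike.re_to_complex, ← h1]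
  have h3 := integral_comp_abs (f := fun y => Real.cos (b * y) * Real.exp (-v * y ^ 2))
  have h4 : ∀ y : ℝ, Real.cos (b * |y|) * Real.exp (-v * |y| ^ 2) =
      Real.cos (b * y) * Real.exp (-v * y ^ 2) := by
    intro y
    rw [sq_abs]
    congr 1
    rcases abs_choice y with h | h <;> rw [h]
    rw [mul_neg, Real.cos_neg]
  simp only [h4] at h3
  have h5 := fourierIntegral_gaussian (b := v) (by simpa using hv) b
  have h6 : ∫ y : ℝ, Complex.exp ((b * y : ℝ) * Complex.I) *
      ((Real.exp (-v * y ^ 2) : ℝ) : ℂ) =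
      ((Real.pi / v) ^ (1 / 2 : ℝ) * Real.exp (-b ^ 2 / (4 * v)) : ℝ) := by
    rw [Complex.ofReal_mul, Complex.ofReal_cpow (by positivity)]
    push_cast
    rw [← h5]
    refine integral_congr_ae (ae_of_all _ fun y => ?_)
    simp only
    ring_nf
  rw [h6, RCLike.re_to_complex, Complex.ofReal_re] at h2
  have h7 : 0 ≤ (Real.pi / v) ^ (1 / 2 : ℝ) * Real.exp (-b ^ 2 / (4 * v)) := by
    have := Real.pi_pos
    positivity
  linarith

end Positivity

section Positivity

open Set Filter Topology

variable {β τ : ℝ}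

/-- Positivity for the approximants of `exp (-τ (iy) ^ β)` built from power series with
nonnegative coefficients. -/
theorem re_integral_approximant_nonneg (hβ₀ : 0 < β) (hβ₁ : β < 1) (hτ : 0 < τ) {c ρ : ℝ}
    (hc : 0 < c) (hρ₀ : 0 ≤ ρ) (hρ₁ : ρ < 1) (ε : ℝ) {v : ℝ} (hv : 0 < v) :
    0 ≤ (∫ y in Ioi (0 : ℝ), Complex.exp ((y : ℝ) * Complex.I) *
      Complex.exp (-(τ * ((1 - ρ * Complex.exp ((-(ε * y) : ℝ) * Complex.I)) * (c : ℂ)) ^ (β : ℂ))) *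
      ((Real.exp (-v * y ^ 2) : ℝ) : ℂ)).re := by
  obtain ⟨a, ha, hsum⟩ := exists_hasSum_cexp_neg_mul_cpow hβ₀ hβ₁ hτ hc
  have hnorm : ∀ y : ℝ, ‖(ρ : ℂ) * Complex.exp ((-(ε * y) : ℝ) * Complex.I)‖ = ρ := by
    intro y
    rw [norm_mul, Complex.norm_exp_ofReal_mul_I, mul_one, Complex.norm_real,
      Real.norm_of_nonneg hρ₀]
  have hsum' : Summable fun k => a k * ρ ^ k := by
    have h := (hsum ρ (by rwa [Complex.norm_real, Real.norm_of_nonneg hρ₀])).summable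
    refine Complex.summable_ofReal.1 (h.congr fun k => ?_)
    push_cast
    rfl
  have hgauss : IntegrableOn (fun y : ℝ => Real.exp (-v * y ^ 2)) (Ioi 0) :=
    (integrable_exp_neg_mul_sq hv).integrableOn
  have key := hasSum_integral_of_dominated_convergence (μ := volume.restrict (Ioi (0 : ℝ)))
    (F := fun (k : ℕ) (y : ℝ) => Complex.exp ((y : ℝ) * Complex.I) *
      ((a k : ℂ) * (ρ * Complex.exp ((-(ε * y) : ℝ) * Complex.I)) ^ k) *
      ((Real.exp (-v * y ^ 2) : ℝ) : ℂ))
    (fun k y => a k * ρ ^ k * Real.exp (-v * y ^ 2))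
    (fun k => by fun_prop)
    (fun k => ae_of_all _ fun y => by
      rw [norm_mul, norm_mul, Complex.norm_exp_ofReal_mul_I, one_mul, norm_mul, norm_pow, hnorm,
        Complex.norm_real, Complex.norm_real, Real.norm_of_nonneg (ha k),
        Real.norm_of_nonneg (Real.exp_pos _).le])
    (ae_of_all _ fun y => hsum'.mul_right _)
    (by
      simp only [tsum_mul_right]
      exact hgauss.const_mul _)
    (ae_of_all _ fun y =>
      ((hsum _ (by rw [hnorm]; exact hρ₁)).mul_left _).mul_right _)
  -- The k-th term is a_k ρ^k times a Gaussian integral of frequency 1 - kε.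
  refine (Complex.hasSum_re key).nonneg fun k => ?_
  have h : ∀ y : ℝ, Complex.exp ((y : ℝ) * Complex.I) *
      ((a k : ℂ) * (ρ * Complex.exp ((-(ε * y) : ℝ) * Complex.I)) ^ k) *
      ((Real.exp (-v * y ^ 2) : ℝ) : ℂ) = ((a k * ρ ^ k : ℝ) : ℂ) *
      (Complex.exp (((1 - k * ε) * y : ℝ) * Complex.I) * ((Real.exp (-v * y ^ 2) : ℝ) : ℂ)) := by
    intro y
    have h1 : Complex.exp (((1 - k * ε) * y : ℝ) * Complex.I) =
        Complex.exp ((y : ℝ) * Complex.I) * Complex.exp ((-(ε * y) : ℝ) * Complex.I) ^ k := by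
      rw [← Complex.exp_nat_mul, ← Complex.exp_add]
      congr 1
      push_cast
      ring
    rw [h1, mul_pow, Complex.ofReal_mul (a k), Complex.ofReal_pow]
    ring
  simp only [h]
  rw [integral_const_mul, Complex.re_ofReal_mul]
  exact mul_nonneg (mul_nonneg (ha k) (pow_nonneg hρ₀ k))
    (re_integral_cexp_mul_gaussian_nonneg _ hv)

/-- For |arg w| < π/2 and β < 1 also |β arg w| < π/2, so Re w^β ≥ 0. This is what makes the
domination uniform in ε. -/
theorem norm_cexp_neg_mul_cpow_le_one (hβ₀ : 0 < β) (hβ₁ : β < 1) (hτ : 0 < τ) {w : ℂ}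
    (hw : 0 < w.re) : ‖Complex.exp (-(τ * w ^ (β : ℂ)))‖ ≤ 1 := by
  rw [Complex.norm_exp, Real.exp_le_one_iff, Complex.neg_re, Complex.re_ofReal_mul, neg_nonpos]
  refine mul_nonneg hτ.le ?_
  have h0 : w ≠ 0 := Complex.ne_zero_of_re_pos hw
  rw [Complex.cpow_def_of_ne_zero h0, Complex.exp_re]
  refine mul_nonneg (Real.exp_pos _).le (Real.cos_nonneg_of_mem_Icc ?_)
  rw [Complex.im_mul_ofReal, Complex.log_im]
  have h := Complex.abs_arg_lt_pi_div_two_iff.2 (Or.inl hw)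
  rw [abs_lt] at h
  have := Real.pi_pos
  constructor <;> nlinarith

/-- The expression equals (1 - e^{-iεy})/ε + εe^{-iεy}, a difference quotient plus a vanishing term.
The radius 1 - ε² keeps the argument inside the disc of convergence without affecting the limit. -/
theorem tendsto_discretised_exponent (y : ℝ) :
    Tendsto (fun ε : ℝ => (1 - ((1 - ε ^ 2 : ℝ) : ℂ) * Complex.exp ((-(ε * y) : ℝ) * Complex.I)) *
      ((ε⁻¹ : ℝ) : ℂ)) (𝓝[>] 0) (𝓝 (y * Complex.I)) := by
  have h1 : HasDerivAt (fun ε : ℝ => Complex.exp ((-(ε * y) : ℝ) * Complex.I))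
      (-(y * Complex.I)) 0 := by
    have h2 : HasDerivAt (fun ε : ℝ => ((-(ε * y) : ℝ) : ℂ) * Complex.I) (-(y * Complex.I)) 0 := by
      have h3 : HasDerivAt (fun ε : ℝ => -(ε * y)) (-y) 0 := by
        simpa using ((hasDerivAt_id (0 : ℝ)).mul_const y).fun_neg
      have := h3.ofReal_comp.mul_const Complex.I
      simpa using this
    simpa using h2.cexp
  have h4 := (h1.tendsto_slope_zero_right).neg
  have h5 : Tendsto (fun ε : ℝ => (ε : ℂ) * Complex.exp ((-(ε * y) : ℝ) * Complex.I))
      (𝓝[>] 0) (𝓝 0) := by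
    have : Continuous fun ε : ℝ => (ε : ℂ) * Complex.exp ((-(ε * y) : ℝ) * Complex.I) := by
      fun_prop
    simpa using (this.tendsto 0).mono_left nhdsWithin_le_nhds
  have h6 := h4.add h5
  rw [neg_neg, add_zero] at h6
  refine h6.congr' ?_
  filter_upwards [self_mem_nhdsWithin] with ε hε
  have hε' : (ε : ℂ) ≠ 0 := by exact_mod_cast (ne_of_gt hε)
  rw [Complex.real_smul]
  simp only [zero_add, zero_mul, neg_zero, Complex.ofReal_zero, Complex.exp_zero]
  push_cast
  field_simp
  ring

theorem mul_I_cpow {y : ℝ} (hy : 0 < y) (β : ℝ) :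
    ((y : ℂ) * Complex.I) ^ (β : ℂ) =
      (y ^ β : ℝ) * Complex.exp ((β * (Real.pi / 2) : ℝ) * Complex.I) := by
  have hy' : (y : ℂ) ≠ 0 := by exact_mod_cast hy.ne'
  rw [Complex.cpow_def_of_ne_zero (mul_ne_zero hy' Complex.I_ne_zero),
    Complex.log_ofReal_mul hy Complex.I_ne_zero, Complex.log_I, Real.rpow_def_of_pos hy,
    Complex.ofReal_exp, ← Complex.exp_add]
  congr 1
  push_cast
  ring

/-- Limit ε → 0 of the approximants with c = 1/ε and ρ = 1 - ε², dominated by the Gaussian. -/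
theorem re_integral_gaussian_regularised_nonneg (hβ₀ : 0 < β) (hβ₁ : β < 1) (hτ : 0 < τ) {v : ℝ}
    (hv : 0 < v) :
    0 ≤ (∫ y in Ioi (0 : ℝ), Complex.exp ((y : ℝ) * Complex.I) *
      Complex.exp (-(τ * ((y : ℂ) * Complex.I) ^ (β : ℂ))) *
      ((Real.exp (-v * y ^ 2) : ℝ) : ℂ)).re := by
  have hgauss : IntegrableOn (fun y : ℝ => Real.exp (-v * y ^ 2)) (Ioi 0) :=
    (integrable_exp_neg_mul_sq hv).integrableOn
  have hmem : ∀ᶠ ε : ℝ in 𝓝[>] 0, ε ∈ Ioo (0 : ℝ) 1 := Ioo_mem_nhdsGT one_pos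
  have hlim := tendsto_integral_filter_of_dominated_convergence
    (μ := volume.restrict (Ioi (0 : ℝ))) (l := 𝓝[>] (0 : ℝ))
    (F := fun (ε y : ℝ) => Complex.exp ((y : ℝ) * Complex.I) *
      Complex.exp (-(τ * ((1 - ((1 - ε ^ 2 : ℝ) : ℂ) *
        Complex.exp ((-(ε * y) : ℝ) * Complex.I)) * ((ε⁻¹ : ℝ) : ℂ)) ^ (β : ℂ))) *
      ((Real.exp (-v * y ^ 2) : ℝ) : ℂ))
    (f := fun y : ℝ => Complex.exp ((y : ℝ) * Complex.I) *
      Complex.exp (-(τ * ((y : ℂ) * Complex.I) ^ (β : ℂ))) * ((Real.exp (-v * y ^ 2) : ℝ) : ℂ))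
    (fun y => Real.exp (-v * y ^ 2))
    (Eventually.of_forall fun ε => Measurable.aestronglyMeasurable (by fun_prop))
    (by
      filter_upwards [hmem] with ε hε
      refine ae_of_all _ fun y => ?_
      have hρ : ‖((1 - ε ^ 2 : ℝ) : ℂ) * Complex.exp ((-(ε * y) : ℝ) * Complex.I)‖ < 1 := by
        rw [norm_mul, Complex.norm_exp_ofReal_mul_I, mul_one, Complex.norm_real,
          Real.norm_of_nonneg (by nlinarith [hε.1, hε.2])]
        nlinarith [hε.1, hε.2]
      have h1 := norm_cexp_neg_mul_cpow_le_one hβ₀ hβ₁ hτ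
        (re_one_sub_mul_pos (inv_pos.2 hε.1) hρ)
      rw [norm_mul, norm_mul, Complex.norm_exp_ofReal_mul_I, one_mul, Complex.norm_real,
        Real.norm_of_nonneg (Real.exp_pos _).le]
      exact mul_le_of_le_one_left (Real.exp_pos _).le h1)
    hgauss
    (by
      filter_upwards [ae_restrict_mem measurableSet_Ioi] with y hy
      have hy' : (0 : ℝ) < y := hy
      have hslit : (y : ℂ) * Complex.I ∈ Complex.slitPlane := by
        rw [Complex.mem_slitPlane_iff]
        right
        simpa using hy'.ne'
      have hcont : ContinuousAt (fun w : ℂ => Complex.exp ((y : ℝ) * Complex.I) *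
          Complex.exp (-(τ * w ^ (β : ℂ))) * ((Real.exp (-v * y ^ 2) : ℝ) : ℂ))
          (y * Complex.I) := by
        have := continuousAt_cpow_const (b := (β : ℂ)) hslit
        fun_prop
      exact hcont.tendsto.comp (tendsto_discretised_exponent y))
  refine ge_of_tendsto ((Complex.continuous_re.tendsto _).comp hlim) ?_
  filter_upwards [hmem] with ε hε
  exact re_integral_approximant_nonneg hβ₀ hβ₁ hτ (inv_pos.2 hε.1)
    (by nlinarith [hε.1, hε.2]) (by nlinarith [hε.1]) ε hv

theorem cexp_mul_cexp_eq_rayKernel {y : ℝ} (hy : 0 < y) :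
    Complex.exp ((y : ℝ) * Complex.I) * Complex.exp (-(τ * ((y : ℂ) * Complex.I) ^ (β : ℂ))) =
      -Complex.I * rayKernel β τ (Real.pi / 2) y := by
  have hI : Complex.exp (((Real.pi / 2 : ℝ) : ℂ) * Complex.I) = Complex.I := by
    push_cast
    exact Complex.exp_pi_div_two_mul_I
  rw [rayKernel, hI, mul_I_cpow hy, ← mul_assoc (τ : ℂ), ← mul_assoc (-Complex.I),
    neg_mul Complex.I Complex.I, Complex.I_mul_I, neg_neg, one_mul]

/-- The cutoff is removed by v → 0. On the vertical ray dσ = i dy, which exchanges real and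
imaginary parts. -/
theorem im_integral_rayKernel_pi_div_two_nonneg (hβ₀ : 0 < β) (hβ₁ : β < 1) (hτ : 0 < τ) :
    0 ≤ (∫ r in Ioi (0 : ℝ), rayKernel β τ (Real.pi / 2) r).im := by
  have hpi := Real.pi_pos
  have hK := integrableOn_rayKernel (β := β) (τ := τ) (θ := Real.pi / 2) hβ₀
    (by rw [Real.cos_pi_div_two])
    (Real.cos_pos_of_mem_Ioo ⟨by nlinarith, by nlinarith⟩) hτ
  have hlim := tendsto_integral_filter_of_dominated_convergence
    (μ := volume.restrict (Ioi (0 : ℝ))) (l := 𝓝[>] (0 : ℝ))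
    (F := fun (v y : ℝ) => Complex.exp ((y : ℝ) * Complex.I) *
      Complex.exp (-(τ * ((y : ℂ) * Complex.I) ^ (β : ℂ))) *
      ((Real.exp (-v * y ^ 2) : ℝ) : ℂ))
    (f := fun y : ℝ => -Complex.I * rayKernel β τ (Real.pi / 2) y)
    (fun y => ‖rayKernel β τ (Real.pi / 2) y‖)
    (Eventually.of_forall fun ε => Measurable.aestronglyMeasurable (by fun_prop))
    (by
      filter_upwards [self_mem_nhdsWithin] with v hv
      filter_upwards [ae_restrict_mem measurableSet_Ioi] with y hy
      rw [cexp_mul_cexp_eq_rayKernel hy, norm_mul, norm_mul, norm_neg, Complex.norm_I, one_mul,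
        Complex.norm_real, Real.norm_of_nonneg (Real.exp_pos _).le]
      refine mul_le_of_le_one_right (norm_nonneg _) (Real.exp_le_one_iff.2 ?_)
      have hv' : (0 : ℝ) < v := hv
      nlinarith [sq_nonneg y])
    hK.norm
    (by
      filter_upwards [ae_restrict_mem measurableSet_Ioi] with y hy
      rw [cexp_mul_cexp_eq_rayKernel hy]
      have : Continuous fun v : ℝ => -Complex.I * rayKernel β τ (Real.pi / 2) y *
          ((Real.exp (-v * y ^ 2) : ℝ) : ℂ) := by fun_prop
      simpa using (this.tendsto 0).mono_left nhdsWithin_le_nhds)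
  have h := ge_of_tendsto ((Complex.continuous_re.tendsto _).comp hlim)
    (by
      filter_upwards [self_mem_nhdsWithin] with v hv
      exact re_integral_gaussian_regularised_nonneg hβ₀ hβ₁ hτ hv)
  rw [integral_const_mul] at h
  simpa using h

/-- The Wright function `W_{-β,1-β}` is nonnegative on the negative half-axis. -/
theorem wrightFunction_neg_nonneg (hβ₀ : 0 < β) (hβ₁ : β < 1) (hτ : 0 < τ) :
    0 ≤ wrightFunction (-β) (1 - β) (-τ) := by
  have hpi := Real.pi_pos
  obtain ⟨α, h1, h2, h3⟩ := exists_angle hβ₀ hβ₁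
  have hκ : 0 < Real.cos (β * α) := Real.cos_pos_of_mem_Ioo ⟨by nlinarith, h3⟩
  have hmem : ∀ᶠ θ : ℝ in 𝓝[>] (Real.pi / 2), θ ∈ Ioo (Real.pi / 2) α := Ioo_mem_nhdsGT h1
  -- For π/2 < θ < α one has cos(βθ) ≥ cos(βα) > 0, which gives a bound independent of θ.
  have hlim := tendsto_integral_filter_of_dominated_convergence
    (μ := volume.restrict (Ioi (0 : ℝ))) (l := 𝓝[>] (Real.pi / 2))
    (F := fun (θ r : ℝ) => rayKernel β τ θ r)
    (f := fun r => rayKernel β τ (Real.pi / 2) r)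
    (fun r => r ^ (0 : ℝ) * Real.exp (-(τ * Real.cos (β * α)) * r ^ β))
    (Eventually.of_forall fun θ => Measurable.aestronglyMeasurable (by unfold rayKernel; fun_prop))
    (by
      filter_upwards [hmem] with θ hθ
      filter_upwards [ae_restrict_mem measurableSet_Ioi] with r hr
      have hr' : (0 : ℝ) < r := hr
      have hcos : Real.cos θ ≤ 0 :=
        (Real.cos_neg_of_pi_div_two_lt_of_lt hθ.1 (by linarith [hθ.2])).le
      have hcos' : Real.cos (β * α) ≤ Real.cos (β * θ) :=
        Real.cos_le_cos_of_nonneg_of_le_pi (by nlinarith [hθ.1]) (by linarith)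
          (by nlinarith [hθ.2])
      rw [norm_rayKernel, Real.rpow_zero]
      have h4 : Real.exp (r * Real.cos θ) ≤ 1 :=
        Real.exp_le_one_iff.2 (mul_nonpos_of_nonneg_of_nonpos hr'.le hcos)
      have h5 : τ * r ^ β * Real.cos (β * α) ≤ τ * r ^ β * Real.cos (β * θ) := by gcongr
      refine mul_le_mul h4 (Real.exp_le_exp.2 ?_) (Real.exp_pos _).le zero_le_one
      linarith)
    (integrableOn_rpow_mul_exp_neg_mul_rpow (by norm_num) hβ₀ (by positivity))
    (ae_of_all _ fun r => by
      have : Continuous fun θ : ℝ => rayKernel β τ θ r := by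
        unfold rayKernel
        fun_prop
      exact (this.tendsto _).mono_left nhdsWithin_le_nhds)
  have hconst : ∀ᶠ θ : ℝ in 𝓝[>] (Real.pi / 2),
      (∫ r in Ioi (0 : ℝ), rayKernel β τ θ r).im =
        Real.pi * β * τ * wrightFunction (-β) (1 - β) (-τ) := by
    filter_upwards [hmem] with θ hθ
    exact (mul_wrightFunction_eq hβ₀ hβ₁ hθ.1 (hθ.2.trans h2) τ).symm
  have heq := tendsto_nhds_unique (((Complex.continuous_im.tendsto _).comp hlim).congr' hconst)
    tendsto_const_nhds
  have h := im_integral_rayKernel_pi_div_two_nonneg hβ₀ hβ₁ hτ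
  rw [heq] at h
  exact nonneg_of_mul_nonneg_right h (by positivity)

end Positivity

/-! ### From moments to the Poisson mixture. -/

section MittagLeffler

open Set

/-- Keep only t > R in Euler's integral. As R is free, Γ(βn+1) outgrows every geometric sequence. -/
theorem rpow_mul_exp_neg_le_Gamma {R x : ℝ} (hR : 0 < R) (hx : 0 ≤ x) :
    R ^ x * Real.exp (-R) ≤ Real.Gamma (x + 1) := by
  have hint := Real.GammaIntegral_convergent (show 0 < x + 1 by linarith)
  rw [Real.Gamma_eq_integral (by linarith), ← integral_exp_neg_Ioi R, ← integral_const_mul]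
  refine le_trans (setIntegral_mono_on ((integrableOn_exp_neg_Ioi R).const_mul _)
    (hint.mono_set (Ioi_subset_Ioi hR.le)) measurableSet_Ioi fun t ht => ?_)
    (setIntegral_mono_set hint ?_ (Ioi_subset_Ioi hR.le).eventuallyLE)
  · rw [add_sub_cancel_right, mul_comm]
    have : R ≤ t := le_of_lt ht
    gcongr
  · filter_upwards [ae_restrict_mem measurableSet_Ioi] with t ht
    have : (0 : ℝ) < t := ht
    positivity

theorem summable_pow_div_Gamma {β : ℝ} (hβ₀ : 0 < β) {s : ℝ} (hs : 0 ≤ s) :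
    Summable fun n : ℕ => s ^ n / Real.Gamma (β * n + 1) := by
  -- Chosen so that R^β = 2(s+1), which makes the ratio of the geometric majorant less than 1.
  set R : ℝ := (2 * (s + 1)) ^ (1 / β) with hR
  have hR₀ : 0 < R := by positivity
  have hRβ : R ^ β = 2 * (s + 1) := by
    rw [hR, ← Real.rpow_mul (by positivity), one_div, inv_mul_cancel₀ hβ₀.ne', Real.rpow_one]
  have hgeo : Summable fun n : ℕ => Real.exp R * (s / (2 * (s + 1))) ^ n :=
    (summable_geometric_of_lt_one (by positivity)
      (by rw [div_lt_one (by positivity)]; linarith)).mul_left _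
  refine Summable.of_nonneg_of_le (fun n => ?_) (fun n => ?_) hgeo
  · have := Real.Gamma_pos_of_pos (show 0 < β * n + 1 by positivity)
    positivity
  · have h := rpow_mul_exp_neg_le_Gamma hR₀ (show 0 ≤ β * (n : ℝ) by positivity)
    rw [Real.rpow_mul hR₀.le, hRβ, Real.rpow_natCast] at h
    calc s ^ n / Real.Gamma (β * n + 1) ≤ s ^ n / ((2 * (s + 1)) ^ n * Real.exp (-R)) := by
          gcongr
      _ = Real.exp R * (s / (2 * (s + 1))) ^ n := by
          rw [Real.exp_neg, div_pow]
          field_simp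

/-- A measure on `[0, ∞)` has the moments `n! / Γ (β n + 1)`. -/
structure HasMittagLefflerMoments (β : ℝ) (ν : Measure ℝ≥0) : Prop where
  integrable (n : ℕ) : Integrable (fun τ : ℝ≥0 => (τ : ℝ) ^ n) ν
  integral_eq (n : ℕ) : ∫ τ : ℝ≥0, (τ : ℝ) ^ n ∂ν = (n ! : ℝ) / Real.Gamma (β * n + 1)

namespace HasMittagLefflerMoments

variable {β : ℝ} {ν : Measure ℝ≥0}

theorem isProbabilityMeasure (h : HasMittagLefflerMoments β ν) : IsProbabilityMeasure ν := by
  have h0 := h.integral_eq 0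
  simp only [pow_zero, integral_const, smul_eq_mul, mul_one, Nat.factorial_zero, Nat.cast_one,
    CharP.cast_eq_zero, mul_zero, zero_add, Real.Gamma_one, div_one] at h0
  constructor
  rwa [measureReal_def, ENNReal.toReal_eq_one_iff] at h0

/-- Termwise integration of e^{zτ} is legitimate for every z, because the integrals of the norms are
|z|^n/Γ(βn+1). -/
theorem complexMGF_eq (hβ₀ : 0 < β) (h : HasMittagLefflerMoments β ν) :
    mittagLeffler β = complexMGF (fun τ : ℝ≥0 => (τ : ℝ)) ν := by
  funext z
  have hF : ∀ n : ℕ, Integrable (fun τ : ℝ≥0 => z ^ n / (n ! : ℂ) * (((τ : ℝ) ^ n : ℝ) : ℂ)) ν :=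
    fun n => (h.integrable n).ofReal.const_mul _
  have hsum := hasSum_integral_of_summable_integral_norm hF (by
    refine (summable_pow_div_Gamma hβ₀ (norm_nonneg z)).congr fun n => ?_
    have h1 : ∀ τ : ℝ≥0, ‖z ^ n / (n ! : ℂ) * (((τ : ℝ) ^ n : ℝ) : ℂ)‖ =
        ‖z‖ ^ n / (n ! : ℝ) * (τ : ℝ) ^ n := by
      intro τ
      rw [norm_mul, norm_div, norm_pow, Complex.norm_natCast, Complex.norm_real,
        Real.norm_of_nonneg (by positivity)]
    simp only [h1]
    rw [integral_const_mul, h.integral_eq]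
    have h2 : (n ! : ℝ) ≠ 0 := by positivity
    field_simp)
  have h3 : ∀ τ : ℝ≥0, ∑' n : ℕ, z ^ n / (n ! : ℂ) * (((τ : ℝ) ^ n : ℝ) : ℂ) =
      Complex.exp (z * (τ : ℝ)) := by
    intro τ
    rw [Complex.exp_eq_exp_ℂ, NormedSpace.exp_eq_tsum_div]
    refine tsum_congr fun n => ?_
    rw [mul_pow]
    push_cast
    ring
  simp only [h3] at hsum
  rw [complexMGF, ← hsum.tsum_eq, mittagLeffler]
  refine tsum_congr fun n => ?_
  have h4 : (β : ℂ) * n + 1 = ((β * n + 1 : ℝ) : ℂ) := by push_cast; rfl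
  have h2 : (n ! : ℂ) ≠ 0 := by exact_mod_cast n.factorial_ne_zero
  rw [integral_const_mul, integral_complex_ofReal, h.integral_eq, h4, Complex.Gamma_ofReal]
  push_cast
  field_simp

theorem iteratedDeriv_mittagLeffler (hβ₀ : 0 < β) (h : HasMittagLefflerMoments β ν) {l : ℝ}
    (hl : 0 < l) (k : ℕ) :
    iteratedDeriv k (mittagLeffler β) (-(l : ℂ)) =
      ((∫ τ : ℝ≥0, (τ : ℝ) ^ k * Real.exp (-(l * τ)) ∂ν : ℝ) : ℂ) := by
  have := h.isProbabilityMeasure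
  -- Since τ ≥ 0 and ν is finite, all s ≤ 0 are admissible, so -l lies in the interior, where
  -- differentiation under the integral is available.
  have hset : Iic (0 : ℝ) ⊆ integrableExpSet (fun τ : ℝ≥0 => (τ : ℝ)) ν := by
    intro s hs
    refine (integrable_const (1 : ℝ)).mono' (by fun_prop) (ae_of_all _ fun τ => ?_)
    rw [Real.norm_of_nonneg (Real.exp_pos _).le]
    exact Real.exp_le_one_iff.2 (mul_nonpos_of_nonpos_of_nonneg hs τ.2)
  have hmem : (-(l : ℂ)).re ∈ interior (integrableExpSet (fun τ : ℝ≥0 => (τ : ℝ)) ν) := by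
    rw [mem_interior_iff_mem_nhds]
    exact Filter.mem_of_superset (Iic_mem_nhds (by simpa using hl)) hset
  rw [h.complexMGF_eq hβ₀, iteratedDeriv_complexMGF hmem, ← integral_complex_ofReal]
  refine integral_congr_ae (ae_of_all _ fun τ => ?_)
  push_cast
  ring_nf

theorem fractionalPoissonMeasure_eq_bind (hβ₀ : 0 < β) (h : HasMittagLefflerMoments β ν) {l : ℝ≥0}
    (hl : 0 < l) :
    fractionalPoissonMeasure β l = ν.bind fun τ : ℝ≥0 => poissonMeasure (l * τ) := by
  have hmeas : Measurable fun τ : ℝ≥0 => poissonMeasure (l * τ) := by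
    refine Measure.measurable_of_measurable_coe _ fun s hs => ?_
    simp only [poissonMeasure, Measure.sum_apply _ hs, Measure.smul_apply, smul_eq_mul]
    fun_prop
  refine Measure.ext_of_singleton fun k => ?_
  rw [fractionalPoissonMeasure, Measure.sum_smul_dirac_singleton,
    Measure.bind_apply (measurableSet_singleton k) hmeas.aemeasurable]
  simp only [poissonMeasure_singleton]
  rw [← ofReal_integral_eq_lintegral_ofReal ?_ (ae_of_all _ fun τ => by positivity),
    fractionalPoissonWeight, h.iteratedDeriv_mittagLeffler hβ₀ (by exact_mod_cast hl),
    Complex.ofReal_re, ← integral_const_mul]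
  · congr 1
    refine integral_congr_ae (ae_of_all _ fun τ => ?_)
    push_cast
    rw [mul_pow]
    ring
  · have := h.isProbabilityMeasure
    refine ((h.integrable k).const_mul ((l : ℝ) ^ k / (k ! : ℝ))).mono' (by fun_prop)
      (ae_of_all _ fun τ => ?_)
    rw [Real.norm_of_nonneg (by positivity)]
    have h1 : Real.exp (-((l * τ : ℝ≥0) : ℝ)) ≤ 1 :=
      Real.exp_le_one_iff.2 (neg_nonpos.2 (NNReal.coe_nonneg _))
    push_cast at h1 ⊢
    rw [mul_pow, div_mul_eq_mul_div]
    exact div_le_div_of_nonneg_right (mul_le_of_le_one_left (by positivity) h1) (by positivity)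

end HasMittagLefflerMoments

theorem mixingDensity_nonneg {β : ℝ} (hβ₀ : 0 < β) (hβ₁ : β < 1) (τ : ℝ≥0) :
    0 ≤ mixingDensity β τ := by
  rcases eq_or_ne τ 0 with rfl | hτ
  -- The contour argument needs τ > 0; at τ = 0 only the term 1/Γ(1-β) survives.
  · rw [mixingDensity, wrightFunction, tsum_eq_single 0]
    · have := Real.Gamma_pos_of_pos (show 0 < 1 - β by linarith)
      simp [this.le]
    · intro n hn
      simp [hn]
  · exact wrightFunction_neg_nonneg hβ₀ hβ₁ (by exact_mod_cast hτ.bot_lt)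

/-- Transfers integrals to Lebesgue measure on ℝ; the endpoint 0 is a null set, so the open
half-line may be used. -/
theorem map_coe_mixingMeasure {β : ℝ} (hβ₁ : β < 1) :
    (mixingMeasure β).map ((↑) : ℝ≥0 → ℝ) = (volume.restrict (Ioi 0)).withDensity
      fun x => ENNReal.ofReal (wrightFunction (-β) (1 - β) (-x)) := by
  have hemb : MeasurableEmbedding ((↑) : ℝ≥0 → ℝ) :=
    MeasurableEmbedding.subtype_coe measurableSet_Ici
  have hcomap : (Measure.comap ((↑) : ℝ≥0 → ℝ) volume).map ((↑) : ℝ≥0 → ℝ) =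
      volume.restrict (Ioi 0) := by
    rw [hemb.map_comap, NNReal.range_coe]
    exact (restrict_Ioi_eq_restrict_Ici).symm
  ext s hs
  rw [hemb.map_apply, mixingMeasure, if_neg hβ₁.ne, withDensity_apply _ (hemb.measurable hs),
    withDensity_apply _ hs, ← hcomap, hemb.restrict_map, hemb.lintegral_map]
  rfl

theorem hasMittagLefflerMoments_mixingMeasure {β : ℝ} (hβ₀ : 0 < β) (hβ₁ : β ≤ 1) :
    HasMittagLefflerMoments β (mixingMeasure β) := by
  rcases hβ₁.eq_or_lt with rfl | hβ₁
  · rw [mixingMeasure, if_pos rfl]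
    refine ⟨fun n => integrable_dirac (by simp), fun n => ?_⟩
    rw [integral_dirac, one_mul, Real.Gamma_nat_eq_factorial, div_self (by positivity)]
    simp
  · have hemb : MeasurableEmbedding ((↑) : ℝ≥0 → ℝ) :=
      MeasurableEmbedding.subtype_coe measurableSet_Ici
    have hmap := map_coe_mixingMeasure hβ₁
    have hmeas : Measurable fun x : ℝ => ENNReal.ofReal (wrightFunction (-β) (1 - β) (-x)) :=
      ((continuous_wrightFunction hβ₀ hβ₁).measurable.comp measurable_neg).ennreal_ofReal
    -- Nonnegativity of the density is essential here: `ENNReal.ofReal` would otherwise truncate it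
    -- and change the moments.
    have hsmul : ∀ n : ℕ, ∀ᵐ x : ℝ ∂(volume.restrict (Ioi 0)),
        (ENNReal.ofReal (wrightFunction (-β) (1 - β) (-x))).toReal • x ^ n =
          x ^ n * wrightFunction (-β) (1 - β) (-x) := by
      intro n
      filter_upwards [ae_restrict_mem measurableSet_Ioi] with x hx
      rw [ENNReal.toReal_ofReal (wrightFunction_neg_nonneg hβ₀ hβ₁ hx), smul_eq_mul, mul_comm]
    refine ⟨fun n => ?_, fun n => ?_⟩
    · have : Integrable (fun x : ℝ => x ^ n) ((mixingMeasure β).map ((↑) : ℝ≥0 → ℝ)) := by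
        rw [hmap, integrable_withDensity_iff_integrable_smul₀' hmeas.aemeasurable (by simp)]
        exact (integrable_congr (hsmul n)).2 (integrableOn_pow_mul_wrightFunction hβ₀ hβ₁ n)
      exact hemb.integrable_map_iff.1 this
    · rw [← hemb.integral_map (fun x : ℝ => x ^ n), hmap,
        integral_withDensity_eq_integral_toReal_smul₀ hmeas.aemeasurable (by simp),
        integral_congr_ae (hsmul n), integral_pow_mul_wrightFunction hβ₀ hβ₁]

end MittagLeffler

theorem lemma3p1 (β : ℝ) (hβ₀ : 0 < β) (hβ₁ : β ≤ 1) :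
    (β < 1 → ∀ τ : ℝ≥0, 0 ≤ mixingDensity β τ) ∧
    IsProbabilityMeasure (mixingMeasure β) ∧
    ∀ l : ℝ≥0, 0 < l →
      (∀ k : ℕ, 0 ≤ iteratedDeriv k (mittagLeffler β) (-((l : ℝ) : ℂ))) ∧
      fractionalPoissonMeasure β l =
        (mixingMeasure β).bind (fun τ : ℝ≥0 => poissonMeasure (l * τ)) := by
  have h := hasMittagLefflerMoments_mixingMeasure hβ₀ hβ₁
  refine ⟨fun hβ τ => mixingDensity_nonneg hβ₀ hβ τ, h.isProbabilityMeasure, fun l hl =>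
    ⟨fun k => ?_, h.fractionalPoissonMeasure_eq_bind hβ₀ hl⟩⟩
  rw [h.iteratedDeriv_mittagLeffler hβ₀ (by exact_mod_cast hl)]
  exact Complex.zero_le_real.2 (integral_nonneg fun τ => by positivity)
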